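/- Let $\Gamma$ be an infinite group with a finite generating set $S$ satisfying $S=S^{-1}$ and $1\notin S$, and let $\Gamma=\langle S\mid R\rangle$ be a presentation of $\Gamma$ on the generators $S$, with $R$ a (possibly infinite) set of words in the elements of $S$ and their formal inverses. For a group $H$ and a finite set $T\subseteq H$ with $T=T^{-1}$, the Cayley graph $G(H,T)$ is the simple graph with vertex set $H$ in which distinct elements $g,h$ are adjacent if and only if $h=gt$ for some $t\in T$. For a graph $G$, let $\sigma_n(v)$ be the number of $n$-step self-avoiding walks (walks visiting no vertex more than once) on $G$ starting at the vertex $v$; the connective constant of $G$ is the number $\mu(G)$ such that $\lim_{n\to\infty}\sigma_n(v)^{1/n}=\mu(G)$ for every vertex $v$ (so $\mu(G)=0$ if $G$ is finite). Let $G=G(\Gamma,S)$. Then $\mu(G)$ exists, and the following hold. (a) Let $\rho$ be a word in the elements of $S$ and their formal inverses whose value in $\Gamma$ is not the identity, let $\Gamma_\rho=\langle S\mid R\cup\{\rho\}\rangle$, and let $G_\rho=G(\Gamma_\rho,S)$ be the Cayley graph of $\Gamma_\rho$ with respect to the image of $S$ in $\Gamma_\rho$. Then $\mu(G_\rho)$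 exists and $\mu(G_\rho)<\mu(G)$. (b) Let $w\in\Gamma$ satisfy $w\ne 1$ and $w\notin S$, and let $\overline G_w=G(\Gamma,S\cup\{w,w^{-1}\})$. Then $\mu(\overline G_w)$ exists and $\mu(G)<\mu(\overline G_w)$. -/

import Mathlib

open Filter Topology

/-- `sawCount G v n` is the number `σ_n(v)` of `n`-step self-avoiding walks on the graph `G` that
start at the vertex `v` (walks that visit no vertex more than once, with any end-point). The graphs
considered here have finite vertex-degrees, so the set counted is finite. -/
noncomputable def sawCount {V : Type*} (G : SimpleGraph V) (v : V) (n : ℕ) : ℕ :=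
  {p : Σ u : V, G.Walk v u | p.2.IsPath ∧ p.2.length = n}.ncard

/-- `μ` is the connective constant of `G`: for every vertex `v`, `σ_n(v) ^ (1 / n) → μ`. -/
def IsConnectiveConstant {V : Type*} (G : SimpleGraph V) (μ : ℝ) : Prop :=
  ∀ v : V, Tendsto (fun n : ℕ => (sawCount G v n : ℝ) ^ (1 / (n : ℝ))) atTop (𝓝 μ)

/-- The value in `Γ` of a word in the elements of `S`. -/
def wordValue {Γ : Type*} [Group Γ] (S : Set Γ) : FreeGroup S →* Γ :=
  FreeGroup.lift (fun s : S => (s : Γ))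

/-- `Γ = ⟨S ∣ R⟩`: the set `S` generates `Γ`, and the words in the elements of `S` that are trivial
in `Γ` are exactly the consequences of the relators in `R`. -/
def IsPresentation {Γ : Type*} [Group Γ] (S : Set Γ) (R : Set (FreeGroup S)) : Prop :=
  Subgroup.closure S = ⊤ ∧ Subgroup.normalClosure R = (wordValue S).ker

/-- The Cayley graph of the group `⟨S ∣ R⟩` given by generators and relators, with respect to the
images of the elements of `S`. -/
def presentedCayley {α : Type*} (R : Set (FreeGroup α)) : SimpleGraph (PresentedGroup R) :=
  SimpleGraph.mulCayley (Set.range (PresentedGroup.of : α → PresentedGroup R))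

/-! Both inequalities are instances of one surplus argument. Self-avoiding walks from 1 are encoded
as words. Words avoiding repetition only before their last step (`Avoiding`) concatenate without
double-counting endpoints, and have the same exponential growth rate as genuine self-avoiding words
(`FullyAvoiding`). Let `l ≥ 1` be the growth rate on the smaller side: the quotient in (a), the old
generators in (b). By Fekete's lemma there are at least `l ^ n` words of length `n`, and this is
sharp up to a subexponential factor. It must be shown that the larger side does not have growth rate
at most `l`.

The walk is changed locally, at many places independently. For this a finite neighbourhood of the
place must not be visited by remote parts of the walk. `exists_scale` supplies such isolated places:
otherwise, on a chain of more than `4 * |E|` scales, some word would have, at every scale, returns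
near at least a quarter of its times. A self-avoiding walk visits each of the `|E|` neighbours of a
point at most once, so this is too many returns.

In a word with `r` blocks, at least `r / 4` blocks can then be rewritten at bounded cost in length.
Choosing which of them to rewrite gives exponentially many outputs. `Marked.ext` decodes the
original word from the output and the bounded list of replacements, so `not_growthLE_of_rewritable`
gives a strictly larger growth rate.

For (a), a shortest non-trivial kernel word yields a path of bounded length leading back to an
earlier vertex in the quotient, but not in `Γ`. Taking it and then repeating part of the walk is
self-avoiding in `Γ`; the first repetition in the quotient marks the place
(`exists_detour_of_shortest`, `mark_of_detour`).

For (b), suppose first that the new edge at a vertex can be continued, avoiding that vertex, to a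
neighbour on the walk. This gives an ear through unvisited vertices (`exists_ear`). Otherwise the
vertex separates the end of the new edge from that neighbour, and inserting the new letter moves the
rest of the walk into another component (`avoiding_insertFlagged`). In both cases the first new
letter is the mark. -/

namespace WordWalk

/-! ### Words, their positions and avoidance. -/

variable {α β Γ H : Type*} [Group Γ] [Group H]

/-- The position after `i` steps of the walk from `1` that follows the word `w`. -/
def pos (φ : α → Γ) (w : List α) (i : ℕ) : Γ := ((w.take i).map φ).prod

/-- The positions at the times `0, …, w.length - 1` are distinct. -/
def Avoiding (φ : α → Γ) (w : List α) : Prop :=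
  ∀ i j, i < j → j < w.length → pos φ w i ≠ pos φ w j

/-- The positions at the times `0, …, w.length` are distinct. -/
def FullyAvoiding (φ : α → Γ) (w : List α) : Prop :=
  ∀ i j, i < j → j ≤ w.length → pos φ w i ≠ pos φ w j

@[simp] lemma pos_zero (φ : α → Γ) (w : List α) : pos φ w 0 = 1 := by simp [pos]

lemma pos_length (φ : α → Γ) (w : List α) : pos φ w w.length = (w.map φ).prod := by simp [pos]

lemma pos_append_of_le (φ : α → Γ) {u : List α} (v : List α) {i : ℕ} (h : i ≤ u.length) :
    pos φ (u ++ v) i = pos φ u i := by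
  simp [pos, List.take_append_of_le_length h]

lemma pos_append_add (φ : α → Γ) (u v : List α) (i : ℕ) :
    pos φ (u ++ v) (u.length + i) = (u.map φ).prod * pos φ v i := by
  simp [pos, List.take_length_add_append]

lemma pos_take (φ : α → Γ) (w : List α) {i k : ℕ} (h : i ≤ k) :
    pos φ (w.take k) i = pos φ w i := by
  simp [pos, List.take_take, h]

lemma pos_add (φ : α → Γ) (w : List α) (k i : ℕ) :
    pos φ w (k + i) = pos φ w k * pos φ (w.drop k) i := by
  simp [pos, List.take_add]

lemma pos_cons_succ (φ : α → Γ) (a : α) (w : List α) (i : ℕ) :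
    pos φ (a :: w) (i + 1) = φ a * pos φ w i := by
  simp [pos]

lemma prod_take (φ : α → Γ) (w : List α) (i : ℕ) : ((w.take i).map φ).prod = pos φ w i := rfl

lemma pos_mul_prod_drop (φ : α → Γ) (w : List α) (i : ℕ) :
    pos φ w i * ((w.drop i).map φ).prod = (w.map φ).prod := by
  rw [pos, ← List.prod_append, ← List.map_append, List.take_append_drop]

lemma pos_map (φ : β → Γ) (ι : α → β) (w : List α) (i : ℕ) :
    pos φ (w.map ι) i = pos (φ ∘ ι) w i := by
  simp [pos, ← List.map_take]

lemma map_pos (f : Γ →* H) (φ : α → Γ) (w : List α) (i : ℕ) :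
    f (pos φ w i) = pos (f ∘ φ) w i := by
  simp [pos, map_list_prod]

lemma map_prod (f : Γ →* H) (φ : α → Γ) (w : List α) :
    f (w.map φ).prod = (w.map (f ∘ φ)).prod := by
  simp [map_list_prod]

lemma Avoiding.ne {φ : α → Γ} {w : List α} (h : Avoiding φ w) {i j : ℕ} (hij : i ≠ j)
    (hi : i < w.length) (hj : j < w.length) : pos φ w i ≠ pos φ w j := by
  rcases lt_or_gt_of_ne hij with h' | h'
  · exact h i j h' hj
  · exact (h j i h' hi).symm

lemma Avoiding.eq {φ : α → Γ} {w : List α} (h : Avoiding φ w) {i j : ℕ}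
    (hi : i < w.length) (hj : j < w.length) (e : pos φ w i = pos φ w j) : i = j := by
  by_contra hij
  exact h.ne hij hi hj e

lemma avoiding_append {φ : α → Γ} {u v : List α} :
    Avoiding φ (u ++ v) ↔ Avoiding φ u ∧ Avoiding φ v ∧
      ∀ i j, i < u.length → j < v.length → pos φ u i ≠ (u.map φ).prod * pos φ v j := by
  constructor
  · intro h
    refine ⟨fun i j hij hj => ?_, fun i j hij hj => ?_, fun i j hi hj => ?_⟩
    · have := h i j hij (by simp; omega)
      rwa [pos_append_of_le φ v (by omega), pos_append_of_le φ v (by omega)] at this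
    · have := h (u.length + i) (u.length + j) (by omega) (by simp; omega)
      rw [pos_append_add, pos_append_add] at this
      exact fun e => this (by rw [e])
    · have := h i (u.length + j) (by omega) (by simp; omega)
      rwa [pos_append_of_le φ v (by omega), pos_append_add] at this
  · rintro ⟨hu, hv, huv⟩ i j hij hj
    rw [List.length_append] at hj
    rcases lt_or_ge j u.length with h | h
    · rw [pos_append_of_le φ v (by omega), pos_append_of_le φ v (by omega)]
      exact hu i j hij h
    · obtain ⟨j, rfl⟩ := Nat.exists_eq_add_of_le h
      rcases lt_or_ge i u.length with h' | h'
      · rw [pos_append_of_le φ v (by omega), pos_append_add]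
        exact huv i j h' (by omega)
      · obtain ⟨i, rfl⟩ := Nat.exists_eq_add_of_le h'
        rw [pos_append_add, pos_append_add]
        exact fun e => hv i j (by omega) (by omega) (mul_left_cancel e)

lemma avoiding_nil (φ : α → Γ) : Avoiding φ [] := fun _ _ _ h => by simp at h

lemma Avoiding.take {φ : α → Γ} {w : List α} (h : Avoiding φ w) (k : ℕ) :
    Avoiding φ (w.take k) := by
  rw [← List.take_append_drop k w] at h
  exact (avoiding_append.1 h).1

lemma Avoiding.drop {φ : α → Γ} {w : List α} (h : Avoiding φ w) (k : ℕ) :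
    Avoiding φ (w.drop k) := by
  rw [← List.take_append_drop k w] at h
  exact (avoiding_append.1 h).2.1

lemma Avoiding.of_prefix {φ : α → Γ} {u w : List α} (h : Avoiding φ w) (hu : u <+: w) :
    Avoiding φ u := by
  obtain ⟨t, rfl⟩ := hu
  exact (avoiding_append.1 h).1

lemma avoiding_cons {φ : α → Γ} {a : α} {v : List α} :
    Avoiding φ (a :: v) ↔ Avoiding φ v ∧ ∀ j < v.length, φ a * pos φ v j ≠ 1 := by
  rw [← List.singleton_append, avoiding_append]
  constructor
  · rintro ⟨-, h, h'⟩
    exact ⟨h, fun j hj e => h' 0 j (by simp) hj (by simpa using e.symm)⟩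
  · rintro ⟨h, h'⟩
    refine ⟨fun i j hij hj => by simp at hj; omega, h, fun i j hi hj => ?_⟩
    obtain rfl : i = 0 := by simpa using hi
    simpa using (h' j hj).symm

lemma avoiding_map {φ : β → Γ} {ι : α → β} {w : List α} :
    Avoiding φ (w.map ι) ↔ Avoiding (φ ∘ ι) w := by
  simp [Avoiding, pos_map]

lemma Avoiding.of_comp {f : Γ →* H} {φ : α → Γ} {w : List α} (h : Avoiding (f ∘ φ) w) :
    Avoiding φ w := fun i j hij hj e => h i j hij hj (by rw [← map_pos, ← map_pos, e])

lemma FullyAvoiding.avoiding {φ : α → Γ} {w : List α} (h : FullyAvoiding φ w) : Avoiding φ w :=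
  fun i j hij hj => h i j hij hj.le

lemma FullyAvoiding.take {φ : α → Γ} {w : List α} (h : FullyAvoiding φ w) (k : ℕ) :
    FullyAvoiding φ (w.take k) := by
  intro i j hij hj
  simp only [List.length_take, le_min_iff] at hj
  rw [pos_take _ _ (by omega), pos_take _ _ (by omega)]
  exact h i j hij hj.2

lemma FullyAvoiding.drop {φ : α → Γ} {w : List α} (h : FullyAvoiding φ w) (k : ℕ) :
    FullyAvoiding φ (w.drop k) := by
  intro i j hij hj e
  simp only [List.length_drop] at hj
  exact h (k + i) (k + j) (by omega) (by omega) (by rw [pos_add, pos_add, e])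

lemma Avoiding.fullyAvoiding_dropLast {φ : α → Γ} {w : List α} (h : Avoiding φ w) (hw : w ≠ []) :
    FullyAvoiding φ w.dropLast := by
  intro i j hij hj
  have := List.length_pos_iff.2 hw
  rw [List.length_dropLast] at hj
  rw [List.dropLast_eq_take, pos_take _ _ (by omega), pos_take _ _ (by omega)]
  exact h i j hij (by omega)

/-! ### Counting self-avoiding words. -/

section count

variable [Finite α]

open Classical in
/-- The words of length `n` whose walk is self-avoiding before its last step. -/
noncomputable def words (φ : α → Γ) (n : ℕ) : Finset (List α) :=
  (List.finite_length_eq α n).toFinset.filter (Avoiding φ)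

open Classical in
/-- The words of length `n` whose walk is self-avoiding. -/
noncomputable def fullWords (φ : α → Γ) (n : ℕ) : Finset (List α) :=
  (List.finite_length_eq α n).toFinset.filter (FullyAvoiding φ)

lemma mem_words {φ : α → Γ} {n : ℕ} {w : List α} :
    w ∈ words φ n ↔ w.length = n ∧ Avoiding φ w := by
  simp [words]

lemma mem_fullWords {φ : α → Γ} {n : ℕ} {w : List α} :
    w ∈ fullWords φ n ↔ w.length = n ∧ FullyAvoiding φ w := by
  simp [fullWords]

lemma card_fullWords_le_card_words (φ : α → Γ) (n : ℕ) :
    (fullWords φ n).card ≤ (words φ n).card := by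
  refine Finset.card_le_card fun w hw => ?_
  rw [mem_fullWords] at hw
  exact mem_words.2 ⟨hw.1, hw.2.avoiding⟩

/-- Dropping the last letter turns a half-open word into a fully avoiding one, so the two counts
have the same exponential growth rate. -/
lemma card_words_succ_le (φ : α → Γ) (n : ℕ) :
    (words φ (n + 1)).card ≤ Nat.card α * (fullWords φ n).card := by
  classical
  have := Fintype.ofFinite α
  rw [Nat.card_eq_fintype_card, mul_comm, ← Finset.card_univ, ← Finset.card_product]
  refine Finset.card_le_card_of_surjOn (fun p : List α × α => p.1 ++ [p.2]) fun w hw => ?_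
  rw [Finset.mem_coe, mem_words] at hw
  have hne : w ≠ [] := by rintro rfl; simp at hw
  refine ⟨(w.dropLast, w.getLast hne), ?_, by simp [List.dropLast_append_getLast]⟩
  simp only [Finset.coe_product, Finset.coe_univ, Set.mem_prod, Finset.mem_coe, Set.mem_univ,
    and_true]
  exact mem_fullWords.2 ⟨by simp [hw.1], hw.2.fullyAvoiding_dropLast hne⟩

lemma card_fullWords_add_le (φ : α → Γ) (m n : ℕ) :
    (fullWords φ (m + n)).card ≤ (fullWords φ m).card * (fullWords φ n).card := by
  classical
  rw [← Finset.card_product]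
  refine Finset.card_le_card_of_injOn (fun w => (w.take m, w.drop m)) (fun w hw => ?_)
    (fun w _ w' _ h => ?_)
  · rw [Finset.mem_coe, mem_fullWords] at hw
    simp only [Finset.coe_product, Set.mem_prod, Finset.mem_coe, mem_fullWords]
    exact ⟨⟨by simp [hw.1], hw.2.take m⟩, by simp [hw.1], hw.2.drop m⟩
  · simp only [Prod.mk.injEq] at h
    rw [← List.take_append_drop m w, h.1, h.2, List.take_append_drop]

end count

end WordWalk

/-! ### Blocks, and a large-deviation bound for the blocks of a word. -/

namespace WordWalk

variable {α β Γ H : Type*} [Group Γ] [Group H]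

/-- The `j`-th block of length `D` of a word. -/
def block (D : ℕ) (w : List α) (j : ℕ) : List α := (w.drop (D * j)).take D

lemma pos_block (φ : α → Γ) (w : List α) {D s : ℕ} (j : ℕ) (hs : s ≤ D) :
    pos φ w (D * j + s) = pos φ w (D * j) * pos φ (block D w j) s := by
  rw [pos_add, block, pos_take _ _ hs]

lemma length_block {D q j : ℕ} {w : List α} (hw : w.length = D * q) (hj : j < q) :
    (block D w j).length = D := by
  have : D * (j + 1) ≤ D * q := Nat.mul_le_mul_left _ hj
  rw [mul_add, mul_one] at this
  simp only [block, List.length_take, List.length_drop, hw]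
  omega

lemma Avoiding.block {φ : α → Γ} {w : List α} (h : Avoiding φ w) (D j : ℕ) :
    Avoiding φ (block D w j) := (h.drop _).take _

lemma getElem?_block {D s : ℕ} (w : List α) (j : ℕ) (hs : s < D) :
    (block D w j)[s]? = w[D * j + s]? := by
  simp [WordWalk.block, hs]

lemma eq_of_block_eq {D q : ℕ} {w w' : List α} (hw : w.length = D * q) (hw' : w'.length = D * q)
    (h : ∀ j < q, WordWalk.block D w j = WordWalk.block D w' j) : w = w' := by
  refine List.ext_getElem? fun i => ?_
  rcases lt_or_ge i (D * q) with hi | hi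
  · have hD : 0 < D := Nat.pos_of_ne_zero (by rintro rfl; simp at hi)
    have := Nat.div_add_mod i D
    rw [← this, ← getElem?_block _ _ (Nat.mod_lt _ hD), ← getElem?_block _ _ (Nat.mod_lt _ hD),
      h _ (Nat.div_lt_of_lt_mul hi)]
  · rw [List.getElem?_eq_none (by omega), List.getElem?_eq_none (by omega)]

/-- The walk visits the `E`-neighbourhood of its position at time `t` only during the block of
length `D` that contains `t`. -/
def Isolated (φ : α → Γ) (E : Finset Γ) (D : ℕ) (w : List α) (t : ℕ) : Prop :=
  ∀ t' < w.length, (pos φ w t)⁻¹ * pos φ w t' ∈ E → t' / D = t / D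

open Classical in
/-- The blocks, among the first `r` of length `D`, that contain an isolated time. -/
noncomputable def goodBlocks (φ : α → Γ) (E : Finset Γ) (D r : ℕ) (w : List α) : Finset ℕ :=
  (Finset.range r).filter fun j => ∃ t < w.length, t / D = j ∧ Isolated φ E D w t

open Classical in
/-- The words made of `r` blocks of length `D`, at least half of which contain an isolated time. -/
noncomputable def goodWords [Finite α] (φ : α → Γ) (E : Finset Γ) (D r : ℕ) : Finset (List α) :=
  (words φ (D * r)).filter fun w => r ≤ 2 * (goodBlocks φ E D r w).card

-- A Chernoff bound. A block has weight `Y` if it lies in `A` and `Y⁻¹` otherwise; the product of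
-- the weights is at least 1 as soon as half of the blocks lie in `A`. The sum of these products
-- over all sequences of blocks factorises.
open Classical in
lemma card_filter_blocks_le [Finite α] (φ : α → Γ) (D q : ℕ) (A : Finset (List α)) {Y : ℝ}
    (hY : 1 ≤ Y) :
    (((words φ (D * q)).filter fun w =>
      q ≤ 2 * ((Finset.range q).filter fun j => block D w j ∈ A).card).card : ℝ) ≤
      (Y * A.card + Y⁻¹ * (words φ D).card) ^ q := by
  set y : List α → ℝ := fun v => if v ∈ A then Y else Y⁻¹ with hy
  have hY0 : 0 < Y := by linarith
  have hy0 : ∀ v, 0 ≤ y v := fun v => by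
    simp only [hy]; split_ifs <;> positivity
  set B := (words φ (D * q)).filter fun w =>
      q ≤ 2 * ((Finset.range q).filter fun j => block D w j ∈ A).card with hB
  have h1 : ∀ w ∈ B, 1 ≤ ∏ j : Fin q, y (block D w j) := by
    intro w hw
    have hw2 := (Finset.mem_filter.1 hw).2
    rw [Fin.prod_univ_eq_prod_range (fun j => y (block D w j)) q]
    simp only [hy]
    rw [Finset.prod_ite, Finset.prod_const, Finset.prod_const, inv_pow, ← div_eq_mul_inv,
      one_le_div (by positivity)]
    refine pow_le_pow_right₀ hY ?_
    have := Finset.card_filter_add_card_filter_not (s := Finset.range q)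
      (fun j => block D w j ∈ A)
    rw [Finset.card_range] at this
    omega
  have hinj : Set.InjOn (fun (w : List α) (j : Fin q) => block D w j) (B : Set (List α)) := by
    intro w hw w' hw' h
    have e := (mem_words.1 (Finset.mem_filter.1 hw).1).1
    have e' := (mem_words.1 (Finset.mem_filter.1 hw').1).1
    exact eq_of_block_eq e e' fun j hj => congrFun h ⟨j, hj⟩
  calc (B.card : ℝ) = ∑ w ∈ B, (1 : ℝ) := by simp
    _ ≤ ∑ w ∈ B, ∏ j : Fin q, y (block D w j) := Finset.sum_le_sum h1
    _ = ∑ g ∈ B.image (fun (w : List α) (j : Fin q) => block D w j), ∏ j : Fin q, y (g j) := by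
        rw [Finset.sum_image hinj]
    _ ≤ ∑ g ∈ Fintype.piFinset (fun _ : Fin q => words φ D), ∏ j : Fin q, y (g j) := by
        refine Finset.sum_le_sum_of_subset_of_nonneg ?_
          fun g _ _ => Finset.prod_nonneg fun j _ => hy0 _
        intro g hg
        obtain ⟨w, hw, rfl⟩ := Finset.mem_image.1 hg
        have e := mem_words.1 (Finset.mem_filter.1 hw).1
        exact Fintype.mem_piFinset.2 fun j => mem_words.2 ⟨length_block e.1 j.2, e.2.block _ _⟩
    _ = (∑ v ∈ words φ D, y v) ^ q := by
        rw [← Finset.prod_univ_sum]; simp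
    _ ≤ (Y * A.card + Y⁻¹ * (words φ D).card) ^ q := by
        refine pow_le_pow_left₀ (Finset.sum_nonneg fun v _ => hy0 v) ?_ q
        calc ∑ v ∈ words φ D, y v ≤ ∑ v ∈ words φ D, ((if v ∈ A then Y else 0) + Y⁻¹) := by
              refine Finset.sum_le_sum fun v _ => ?_
              simp only [hy]
              have : 0 < Y⁻¹ := by positivity
              split_ifs <;> linarith
          _ ≤ _ := by
              rw [Finset.sum_add_distrib, ← Finset.sum_filter, Finset.sum_const, Finset.sum_const,
                nsmul_eq_mul, nsmul_eq_mul, mul_comm Y, mul_comm Y⁻¹]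
              gcongr
              exact fun v hv => (Finset.mem_filter.1 hv).2

/-- The growth rate of a sequence is at most `l`. -/
def GrowthLE (a : ℕ → ℕ) (l : ℝ) : Prop :=
  ∀ x > l, ∃ C : ℝ, 0 < C ∧ ∀ n, (a n : ℝ) ≤ C * x ^ n

-- If `A r` is exponentially smaller than `l ^ (D * r)`, words with half of their blocks in `A r`
-- are rare. The Chernoff weight is `ξ ^ (D * r)` with `1 < ξ < l / x`: then `x * ξ < l`, and the
-- remaining blocks contribute a rate `z / ξ < l`, where `z` is slightly above `l`.
open Classical in
lemma exists_level [Finite α] {φ : α → Γ} {l : ℝ} (hl : 0 < l)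
    (hub : GrowthLE (fun n => (words φ n).card) l) {D : ℕ} (hD : 0 < D)
    (A : ℕ → Finset (List α)) {x : ℝ} (hx : 0 < x) (hxl : x < l)
    (hA : ∀ᶠ r in atTop, ((A r).card : ℝ) ≤ x ^ (D * r)) {κ : ℝ} (hκ : 0 < κ) :
    ∃ r > 0, ∀ q, (((words φ (D * r * q)).filter fun w =>
      q ≤ 2 * ((Finset.range q).filter fun j => block (D * r) w j ∈ A r).card).card : ℝ) ≤
      κ ^ q * l ^ (D * r * q) := by
  obtain ⟨ξ, hξ1, hξ2⟩ : ∃ ξ : ℝ, 1 < ξ ∧ ξ < l / x := exists_between ((one_lt_div hx).2 hxl)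
  have hξ0 : 0 < ξ := by linarith
  obtain ⟨z, hz1, hz2⟩ : ∃ z : ℝ, l < z ∧ z < l * ξ := exists_between (by nlinarith)
  have hz0 : 0 < z := by linarith
  obtain ⟨C, hC, hCz⟩ := hub z hz1
  have e1 : x * ξ / l < 1 := by rw [div_lt_one hl, mul_comm]; exact (lt_div_iff₀ hx).1 hξ2
  have e2 : z / ξ / l < 1 := by rw [div_lt_one hl, div_lt_iff₀ hξ0]; exact hz2
  have hlim : Tendsto (fun r : ℕ => (x * ξ / l) ^ (D * r) + C * (z / ξ / l) ^ (D * r))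
      atTop (𝓝 (0 + C * 0)) := by
    have ht : Tendsto (fun r : ℕ => D * r) atTop atTop := tendsto_id.const_mul_atTop' hD
    refine ((tendsto_pow_atTop_nhds_zero_of_lt_one (by positivity) e1).comp ht).add
      (((tendsto_pow_atTop_nhds_zero_of_lt_one (by positivity) e2).comp ht).const_mul C)
  rw [mul_zero, add_zero] at hlim
  obtain ⟨r, hr, hrA, hrκ⟩ := ((eventually_gt_atTop 0).and (hA.and
    (hlim.eventually (gt_mem_nhds hκ)))).exists
  refine ⟨r, hr, fun q => ?_⟩
  refine (card_filter_blocks_le φ (D * r) q (A r) (one_le_pow₀ hξ1.le (n := D * r))).trans ?_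
  rw [pow_mul l, ← mul_pow]
  refine pow_le_pow_left₀ (by positivity) ?_ q
  have hlp : 0 < l ^ (D * r) := by positivity
  calc ξ ^ (D * r) * ((A r).card : ℝ) + (ξ ^ (D * r))⁻¹ * ((words φ (D * r)).card : ℝ)
      ≤ ξ ^ (D * r) * x ^ (D * r) + (ξ ^ (D * r))⁻¹ * (C * z ^ (D * r)) := by
        gcongr; exact hCz _
    _ = ((x * ξ / l) ^ (D * r) + C * (z / ξ / l) ^ (D * r)) * l ^ (D * r) := by
        simp only [div_pow, mul_pow]
        field_simp
    _ ≤ κ * l ^ (D * r) := by gcongr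

end WordWalk

/-! ### The multi-scale argument for isolated times. -/

namespace WordWalk

variable {α β Γ H : Type*} [Group Γ] [Group H]

lemma sum_range_mul_eq (h : ℕ → ℕ) (m k : ℕ) :
    ∑ t ∈ Finset.range (m * k), h t =
      ∑ j ∈ Finset.range k, ∑ s ∈ Finset.range m, h (m * j + s) := by
  induction k with
  | zero => simp
  | succ k ih => rw [mul_add, mul_one, Finset.sum_range_add, ih, Finset.sum_range_succ]

/-- At time `t` the walk has an `E`-neighbour in the same block of length `D'` but in another block
of length `D`. -/
def Returns (φ : α → Γ) (E : Finset Γ) (D D' : ℕ) (w : List α) (t : ℕ) : Prop :=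
  ∃ t' < w.length, (pos φ w t)⁻¹ * pos φ w t' ∈ E ∧ t' / D' = t / D' ∧ t' / D ≠ t / D

-- More than half of the long blocks are not good words, and in each of these more than half of the
-- short blocks contain no isolated time. Every time in such a short block has an `E`-neighbour in
-- another short block of the same long block. This accounts for a quarter of all times.
open Classical in
lemma le_card_returns [Finite α] {φ : α → Γ} {E : Finset Γ} {D r q : ℕ} (hD : 0 < D) (hr : 0 < r)
    {w : List α} (hw : w ∈ words φ (D * r * q))
    (h : 2 * ((Finset.range q).filter fun j =>
      block (D * r) w j ∈ goodWords φ E D r).card < q) :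
    D * r * q ≤ 4 * ((Finset.range (D * r * q)).filter (Returns φ E D (D * r) w)).card := by
  obtain ⟨hlen, hav⟩ := mem_words.1 hw
  set ind : ℕ → ℕ := fun t => if Returns φ E D (D * r) w t then 1 else 0 with hind
  have hcard : ((Finset.range (D * r * q)).filter (Returns φ E D (D * r) w)).card =
      ∑ j ∈ Finset.range q, ∑ i ∈ Finset.range r, ∑ s ∈ Finset.range D,
        ind (D * r * j + (D * i + s)) := by
    rw [Finset.card_filter, sum_range_mul_eq]
    refine Finset.sum_congr rfl fun j _ => ?_
    rw [sum_range_mul_eq]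
  have key : ∀ j < q, block (D * r) w j ∉ goodWords φ E D r →
      D * r ≤ 2 * ∑ i ∈ Finset.range r, ∑ s ∈ Finset.range D,
        ind (D * r * j + (D * i + s)) := by
    intro j hj hjg
    set v := block (D * r) w j with hv
    have hvlen : v.length = D * r := length_block hlen hj
    have hvw : v ∈ words φ (D * r) := mem_words.2 ⟨hvlen, hav.block _ _⟩
    have hvb : 2 * (goodBlocks φ E D r v).card < r := by
      by_contra h'
      exact hjg (Finset.mem_filter.2 ⟨hvw, by omega⟩)
    have hsub : goodBlocks φ E D r v ⊆ Finset.range r := Finset.filter_subset _ _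
    have hc : r ≤ 2 * (Finset.range r \ goodBlocks φ E D r v).card := by
      rw [Finset.card_sdiff_of_subset hsub, Finset.card_range]; omega
    have hone : ∀ i ∈ Finset.range r \ goodBlocks φ E D r v, ∀ s ∈ Finset.range D,
        ind (D * r * j + (D * i + s)) = 1 := by
      intro i hi s hs
      rw [Finset.mem_sdiff, Finset.mem_range] at hi
      rw [Finset.mem_range] at hs
      have ht : D * i + s < D * r := by
        have : D * (i + 1) ≤ D * r := Nat.mul_le_mul_left _ hi.1
        rw [mul_add, mul_one] at this; omega
      have hti : (D * i + s) / D = i := by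
        rw [Nat.mul_add_div hD, Nat.div_eq_of_lt hs, add_zero]
      have hni : ¬ Isolated φ E D v (D * i + s) := fun hiso =>
        hi.2 (Finset.mem_filter.2 ⟨Finset.mem_range.2 hi.1, D * i + s, by omega, hti, hiso⟩)
      simp only [Isolated, not_forall] at hni
      obtain ⟨t', ht', hE, hne⟩ := hni
      simp only [hind]
      rw [if_pos]
      have hDr : 0 < D * r := by positivity
      have hle : D * r * (j + 1) ≤ D * r * q := Nat.mul_le_mul_left _ hj
      rw [mul_add, mul_one] at hle
      refine ⟨D * r * j + t', by omega, ?_, ?_, ?_⟩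
      · rw [pos_block φ w j ht.le, pos_block φ w j (by omega)]
        simpa [mul_assoc] using hE
      · rw [Nat.mul_add_div hDr, Nat.mul_add_div hDr, Nat.div_eq_of_lt ht,
          Nat.div_eq_of_lt (by omega)]
      · rw [mul_assoc, Nat.mul_add_div hD, Nat.mul_add_div hD]
        omega
    calc D * r ≤ D * (2 * (Finset.range r \ goodBlocks φ E D r v).card) :=
          Nat.mul_le_mul_left _ hc
      _ = 2 * ∑ i ∈ Finset.range r \ goodBlocks φ E D r v, ∑ s ∈ Finset.range D,
        ind (D * r * j + (D * i + s)) := by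
          rw [Finset.sum_congr rfl fun i hi => Finset.sum_congr rfl (hone i hi)]
          simp; ring
      _ ≤ _ := Nat.mul_le_mul_left _ (Finset.sum_le_sum_of_subset Finset.sdiff_subset)
  set J := (Finset.range q).filter fun j => block (D * r) w j ∈ goodWords φ E D r with hJ
  have hJs : J ⊆ Finset.range q := Finset.filter_subset _ _
  have hJc : q ≤ 2 * (Finset.range q \ J).card := by
    rw [Finset.card_sdiff_of_subset hJs, Finset.card_range]; omega
  rw [hcard]
  calc D * r * q ≤ D * r * (2 * (Finset.range q \ J).card) := Nat.mul_le_mul_left _ hJc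
    _ = 2 * ∑ j ∈ Finset.range q \ J, D * r := by simp; ring
    _ ≤ 2 * ∑ j ∈ Finset.range q \ J, 2 * ∑ i ∈ Finset.range r, ∑ s ∈ Finset.range D,
        ind (D * r * j + (D * i + s)) := by
        refine Nat.mul_le_mul_left _ (Finset.sum_le_sum fun j hj => ?_)
        rw [Finset.mem_sdiff, hJ, Finset.mem_filter] at hj
        exact key j (Finset.mem_range.1 hj.1) fun h' => hj.2 ⟨hj.1, h'⟩
    _ ≤ 2 * ∑ j ∈ Finset.range q, 2 * ∑ i ∈ Finset.range r, ∑ s ∈ Finset.range D,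
        ind (D * r * j + (D * i + s)) :=
        Nat.mul_le_mul_left _ (Finset.sum_le_sum_of_subset Finset.sdiff_subset)
    _ = _ := by rw [← Finset.mul_sum]; ring

/-- There is a scale `D` such that, up to a subexponential factor, as many self-avoiding words as
one likes have an isolated time in at least half of their blocks of length `D`. -/
theorem exists_scale [Finite α] {φ : α → Γ} {l : ℝ} (hl : 0 < l)
    (hlb : ∀ n, l ^ n ≤ ((words φ n).card : ℝ))
    (hub : GrowthLE (fun n => (words φ n).card) l) (E : Finset Γ) :
    ∃ D > 0, ∀ x : ℝ, 0 < x → x < l →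
      ∃ᶠ r in atTop, x ^ (D * r) < ((goodWords φ E D r).card : ℝ) := by
  classical
  by_contra hcon
  push Not at hcon
  -- More scales than four times the number of returns that a single time can have.
  set L := 4 * E.card + 1 with hL
  -- With this factor the bad words of all `L` scales together make up at most `l ^ n / 2`, fewer
  -- than all words.
  have hκ : (0 : ℝ) < 1 / (2 * L) := by positivity
  have hstep : ∀ D > 0, ∃ r > 0, ∀ q, (((words φ (D * r * q)).filter fun w =>
      q ≤ 2 * ((Finset.range q).filter fun j =>
        block (D * r) w j ∈ goodWords φ E D r).card).card : ℝ) ≤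
      (1 / (2 * L) : ℝ) ^ q * l ^ (D * r * q) := by
    intro D hD
    obtain ⟨x, hx, hxl, hev⟩ := hcon D hD
    exact exists_level hl hub hD (goodWords φ E D) hx hxl hev hκ
  choose! rf hrf hrq using hstep
  -- Each scale is a multiple of the preceding one, by the factor that the failure of that scale
  -- provides.
  let sc : ℕ → ℕ := fun i => Nat.rec 1 (fun _ D => D * rf D) i
  have sc_succ : ∀ i, sc (i + 1) = sc i * rf (sc i) := fun i => rfl
  have sc_pos : ∀ i, 0 < sc i := by
    intro i
    induction i with
    | zero => exact one_pos
    | succ i ih => rw [sc_succ]; exact Nat.mul_pos ih (hrf _ ih)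
  have sc_dvd : ∀ i j, i ≤ j → sc i ∣ sc j := by
    intro i j hij
    induction j, hij using Nat.le_induction with
    | base => exact dvd_rfl
    | succ j _ ih => exact ih.trans (by rw [sc_succ]; exact dvd_mul_right _ _)
  set n := sc L with hn
  have hn0 : 0 < n := sc_pos L
  set q : ℕ → ℕ := fun i => n / sc (i + 1) with hq
  have hnq : ∀ i < L, sc i * rf (sc i) * q i = n := fun i hi => by
    rw [← sc_succ]; exact Nat.mul_div_cancel' (sc_dvd _ _ hi)
  set bad : ℕ → Finset (List α) := fun i => (words φ n).filter fun w =>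
      q i ≤ 2 * ((Finset.range (q i)).filter fun j =>
        block (sc i * rf (sc i)) w j ∈ goodWords φ E (sc i) (rf (sc i))).card with hbad
  have hbadc : ∀ i < L, ((bad i).card : ℝ) ≤ 1 / (2 * L) * l ^ n := by
    intro i hi
    have h1 := hrq (sc i) (sc_pos i) (q i)
    rw [hnq i hi] at h1
    refine h1.trans ?_
    have hq1 : q i ≠ 0 := by
      intro h0
      have := hnq i hi
      rw [h0, mul_zero] at this; omega
    have hκ1 : (1 / (2 * L) : ℝ) ≤ 1 := by
      rw [div_le_one (by positivity)]
      have : (1 : ℝ) ≤ L := by exact_mod_cast (by omega : 1 ≤ L)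
      linarith
    gcongr
    exact pow_le_of_le_one hκ.le hκ1 hq1
  obtain ⟨w, hw, hwb⟩ : ∃ w ∈ words φ n, ∀ i < L, w ∉ bad i := by
    by_contra hno
    push Not at hno
    have hsub : words φ n ⊆ (Finset.range L).biUnion bad := fun w hw => by
      obtain ⟨i, hi, hwi⟩ := hno w hw
      exact Finset.mem_biUnion.2 ⟨i, Finset.mem_range.2 hi, hwi⟩
    have h1 : ((words φ n).card : ℝ) ≤ ∑ i ∈ Finset.range L, ((bad i).card : ℝ) := by
      exact_mod_cast (Finset.card_le_card hsub).trans Finset.card_biUnion_le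
    have h2 : ∑ i ∈ Finset.range L, ((bad i).card : ℝ) ≤
        ∑ i ∈ Finset.range L, 1 / (2 * L) * l ^ n :=
      Finset.sum_le_sum fun i hi => hbadc i (Finset.mem_range.1 hi)
    rw [Finset.sum_const, Finset.card_range, nsmul_eq_mul] at h2
    have h3 : (L : ℝ) * (1 / (2 * L) * l ^ n) = l ^ n / 2 := by
      have : (L : ℝ) ≠ 0 := by positivity
      field_simp
    have h4 : 0 < l ^ n := by positivity
    linarith [hlb n]
  obtain ⟨hlen, hav⟩ := mem_words.1 hw
  set hits : ℕ → ℕ → Prop := fun i t => Returns φ E (sc i) (sc (i + 1)) w t with hhits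
  have hlow : ∀ i < L, n ≤ 4 * ((Finset.range n).filter (hits i)).card := by
    intro i hi
    have := le_card_returns (φ := φ) (E := E) (q := q i) (w := w) (sc_pos i) (hrf _ (sc_pos i))
      (by rw [hnq i hi]; exact hw)
      (by
        by_contra h'
        exact hwb i hi (Finset.mem_filter.2 ⟨hw, by omega⟩))
    rwa [hnq i hi] at this
  have hup : ∀ t, ((Finset.range L).filter fun i => hits i t).card ≤ E.card := by
    intro t
    have hch : ∀ i, ∃ t', hits i t → t' < w.length ∧ (pos φ w t)⁻¹ * pos φ w t' ∈ E ∧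
        t' / sc (i + 1) = t / sc (i + 1) ∧ t' / sc i ≠ t / sc i := by
      intro i
      by_cases h : hits i t
      · obtain ⟨t', h1, h2⟩ := h
        exact ⟨t', fun _ => ⟨h1, h2⟩⟩
      · exact ⟨0, fun h' => absurd h' h⟩
    choose τ hτ using hch
    -- The return at scale `i` shares the block of length `sc (i + 1)` with `t`, hence also the
    -- block of length `sc j`; the return at scale `j` leaves that block. So returns at different
    -- scales occur at different times, and by self-avoidance they use different elements of `E`.
    have hne : ∀ i j, i < j → hits i t → hits j t → τ i ≠ τ j := by
      intro i j hij hi hj e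
      obtain ⟨c, hc⟩ := sc_dvd (i + 1) j hij
      have h1 := (hτ i hi).2.2.1
      have h2 := (hτ j hj).2.2.2
      apply h2
      rw [← e, hc, ← Nat.div_div_eq_div_mul (τ i) (sc (i + 1)) c,
        ← Nat.div_div_eq_div_mul t (sc (i + 1)) c, h1]
    refine Finset.card_le_card_of_injOn (fun i => (pos φ w t)⁻¹ * pos φ w (τ i))
      (fun i hi => (hτ i (Finset.mem_filter.1 hi).2).2.1) ?_
    intro i hi j hj e
    have hi' := (Finset.mem_filter.1 hi).2
    have hj' := (Finset.mem_filter.1 hj).2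
    have e' := hav.eq (hτ i hi').1 (hτ j hj').1 (mul_left_cancel e)
    by_contra hij
    rcases lt_or_gt_of_ne hij with h | h
    · exact hne i j h hi' hj' e'
    · exact hne j i h hj' hi' e'.symm
  -- Double counting of the pairs of a scale and a time that has a return at this scale.
  have hsum : ∑ i ∈ Finset.range L, ((Finset.range n).filter (hits i)).card =
      ∑ t ∈ Finset.range n, ((Finset.range L).filter fun i => hits i t).card := by
    simp only [Finset.card_filter]
    exact Finset.sum_comm
  have h1 : L * n ≤ 4 * ∑ i ∈ Finset.range L, ((Finset.range n).filter (hits i)).card := by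
    rw [Finset.mul_sum]
    calc L * n = ∑ _i ∈ Finset.range L, n := by simp
      _ ≤ _ := Finset.sum_le_sum fun i hi => hlow i (Finset.mem_range.1 hi)
  have h2 : ∑ t ∈ Finset.range n, ((Finset.range L).filter fun i => hits i t).card ≤
      n * E.card := by
    calc _ ≤ ∑ _t ∈ Finset.range n, E.card := Finset.sum_le_sum fun t _ => hup t
      _ = n * E.card := by simp
  rw [hsum] at h1
  have h3 : L * n ≤ 4 * E.card * n := by
    calc L * n ≤ 4 * (n * E.card) := h1.trans (Nat.mul_le_mul_left _ h2)
      _ = _ := by ring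
  rw [hL, add_mul, one_mul] at h3
  omega

end WordWalk

/-! ### Rewriting blocks, and decoding a rewritten word. -/

namespace WordWalk

variable {α β Γ H : Type*} [Group Γ] [Group H]

/-- A piece of a rewritten word: a block that is kept, or a block `g.1` that is replaced by
`g.2.1 ++ g.2.2`. -/
abbrev Piece (α β : Type*) := List α ⊕ (List α × List β × List β)

/-- The rewritten form of a piece. -/
def Piece.out (ι : α → β) : Piece α β → List β := Sum.elim (List.map ι) fun g => g.2.1 ++ g.2.2

/-- The replacements in a list of pieces. -/
def replaced (W : List (Piece α β)) : List (List α × List β × List β) :=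
  W.filterMap Sum.getRight?

lemma replaced_inl (b : List α) (W : List (Piece α β)) : replaced (Sum.inl b :: W) = replaced W :=
  rfl

lemma replaced_inr (g : List α × List β × List β) (W : List (Piece α β)) :
    replaced (Sum.inr g :: W) = g :: replaced W := rfl

lemma Piece.out_inl (ι : α → β) (b : List α) : Piece.out ι (Sum.inl b) = b.map ι := rfl

lemma Piece.out_inr (ι : α → β) (g : List α × List β × List β) :
    Piece.out ι (Sum.inr g) = g.2.1 ++ g.2.2 := rfl

/-- The end of the first part of each replacement is detected by the prefix-closed property `K`,
whichever kept blocks are read before it. -/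
def Marked (ι : α → β) (K : List β → Prop) (W : List (Piece α β)) : Prop :=
  ∀ (P : List (List α)) (g : List α × List β × List β) (Y : List (Piece α β)),
    (P.map Sum.inl ++ Sum.inr g :: Y) <:+ W →
    ¬ K (P.flatten.map ι ++ g.2.1) ∧ K (P.flatten.map ι ++ g.2.1.dropLast)

lemma exists_of_replaced_eq_cons {W : List (Piece α β)} {g : List α × List β × List β}
    {G : List (List α × List β × List β)} (h : replaced W = g :: G) :
    ∃ (P : List (List α)) (Y : List (Piece α β)), W = P.map Sum.inl ++ Sum.inr g :: Y := by
  induction W with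
  | nil => simp [replaced] at h
  | cons x W ih =>
    rcases x with b | g'
    · obtain ⟨P, Y, rfl⟩ := ih (by rwa [replaced_inl] at h)
      exact ⟨b :: P, Y, rfl⟩
    · obtain rfl : g' = g := by
        rw [replaced_inr] at h; exact (List.cons.inj h).1
      exact ⟨[], W, rfl⟩

/-- Both readings have the same next replacement `g`. The reading that starts with `g` says that `K`
fails on `g.2.1`. The other reads a non-empty kept part before `g`, so its prefix on which `K` still
holds is at least as long as `g.2.1`; this contradicts prefix-closedness. -/
lemma not_marked_both {ι : α → β} {K : List β → Prop}
    (hK : ∀ u v, u <+: v → K v → K u) {b : List α} (hb : b ≠ []) {g : List α × List β × List β}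
    {W₁ W₂ : List (Piece α β)} (h₁ : Marked ι K (Sum.inl b :: W₁))
    (h₂ : Marked ι K (Sum.inr g :: W₂))
    (hout : (Sum.inl b :: W₁).flatMap (Piece.out ι) = (Sum.inr g :: W₂).flatMap (Piece.out ι))
    (hrep : replaced (Sum.inl b :: W₁) = replaced (Sum.inr g :: W₂)) : False := by
  have h2 := h₂ [] g W₂ List.suffix_rfl
  simp only [List.flatten_nil, List.map_nil, List.nil_append] at h2
  have hg : replaced W₁ = g :: replaced W₂ := by
    rwa [replaced_inl, replaced_inr] at hrep
  obtain ⟨P, Y, rfl⟩ := exists_of_replaced_eq_cons hg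
  have h1 := (h₁ (b :: P) g Y List.suffix_rfl).2
  have hz : g.2.1 ≠ [] := by
    intro h0
    rw [h0] at h2
    exact h2.1 h2.2
  set p := (b :: P).flatten.map ι with hp
  have e1 : (Sum.inl b :: (P.map Sum.inl ++ Sum.inr g :: Y)).flatMap (Piece.out ι) =
      p ++ (g.2.1 ++ (g.2.2 ++ Y.flatMap (Piece.out ι))) := by
    have : ∀ P : List (List α), (P.map Sum.inl).flatMap (Piece.out (β := β) ι) =
        P.flatten.map ι := by
      intro P
      induction P with
      | nil => rfl
      | cons b P ih =>
        rw [List.map_cons, List.flatMap_cons, ih, Piece.out_inl, List.flatten_cons,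
          List.map_append]
    rw [List.flatMap_cons, List.flatMap_append, List.flatMap_cons, this, Piece.out_inl,
      Piece.out_inr, hp, List.flatten_cons, List.map_append]
    simp only [List.append_assoc]
  rw [e1] at hout
  have hpre1 : g.2.1 <+: p ++ (g.2.1 ++ (g.2.2 ++ Y.flatMap (Piece.out ι))) := by
    rw [hout]
    exact ⟨g.2.2 ++ W₂.flatMap (Piece.out ι), by simp [Piece.out]⟩
  have hpre2 : p ++ g.2.1.dropLast <+: p ++ (g.2.1 ++ (g.2.2 ++ Y.flatMap (Piece.out ι))) :=
    (List.prefix_append_right_inj p).2 ((List.dropLast_prefix _).trans (List.prefix_append _ _))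
  have hpl : 1 ≤ p.length := by
    have := List.length_pos_iff.2 hb
    simp [hp]; omega
  have := List.prefix_of_prefix_length_le hpre1 hpre2 (by simp; omega)
  exact h2.1 (hK _ _ this h1)

lemma Marked.tail {ι : α → β} {K : List β → Prop} {x : Piece α β} {W : List (Piece α β)}
    (h : Marked ι K (x :: W)) : Marked ι K W :=
  fun P g Y hs => h P g Y (hs.trans (List.suffix_cons _ _))

/-- A marked list of pieces is determined by its output and its replacements. -/
lemma Marked.ext {ι : α → β} (hι : Function.Injective ι) {K : List β → Prop}
    (hK : ∀ u v, u <+: v → K v → K u) {D : ℕ} (hD : 0 < D) {W₁ W₂ : List (Piece α β)}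
    (h₁ : Marked ι K W₁) (h₂ : Marked ι K W₂) (hl₁ : ∀ b, Sum.inl b ∈ W₁ → b.length = D)
    (hl₂ : ∀ b, Sum.inl b ∈ W₂ → b.length = D)
    (hout : W₁.flatMap (Piece.out ι) = W₂.flatMap (Piece.out ι))
    (hrep : replaced W₁ = replaced W₂) : W₁ = W₂ := by
  have hne : ∀ b : List α, b.length = D → b ≠ [] := by
    rintro _ hb rfl; simp at hb; omega
  induction W₁ generalizing W₂ with
  | nil =>
    rcases W₂ with _ | ⟨x | g, W₂⟩
    · rfl
    · have := hne x (hl₂ x (by simp))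
      simp [Piece.out] at hout
      exact absurd hout.1 this
    · simp [replaced] at hrep
  | cons x W₁ ih =>
    rcases W₂ with _ | ⟨y, W₂⟩
    · rcases x with x | g
      · have := hne x (hl₁ x (by simp))
        simp [Piece.out] at hout
        exact absurd hout.1 this
      · simp [replaced] at hrep
    · have step : x = y → x :: W₁ = y :: W₂ := by
        rintro rfl
        rw [ih h₁.tail h₂.tail (fun b hb => hl₁ b (by simp [hb]))
          (fun b hb => hl₂ b (by simp [hb])) (by simpa using hout) ?_]
        rcases x with x | g
        · exact hrep
        · exact (List.cons.inj hrep).2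
      rcases x with b | g <;> rcases y with b' | g'
      · refine step ?_
        have e := List.append_inj_left (by simpa [Piece.out] using hout :
          b.map ι ++ W₁.flatMap (Piece.out ι) = b'.map ι ++ W₂.flatMap (Piece.out ι))
          (by simp [hl₁ b (by simp), hl₂ b' (by simp)])
        rw [List.map_injective_iff.2 hι e]
      · exact (not_marked_both hK (hne b (hl₁ b (by simp))) h₁ h₂ hout hrep).elim
      · exact (not_marked_both hK (hne b' (hl₂ b' (by simp))) h₂ h₁ hout.symm hrep.symm).elim
      · refine step ?_
        have : g = g' := (List.cons.inj hrep).1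
        rw [this]

/-- The pieces of `π` when its blocks with indices in `T` are replaced. -/
def pieces (D : ℕ) (π : List α) (z y : ℕ → List β) (T : Finset ℕ) (r : ℕ) : List (Piece α β) :=
  (List.range r).map fun j =>
    if j ∈ T then Sum.inr (block D π j, z j, y j) else Sum.inl (block D π j)

/-- At least a quarter of the `r` blocks of `π` may be replaced independently of each other, so that
the resulting words have property `A` and the replacements are marked by `K`. -/
def Rewritable (ι : α → β) (K A : List β → Prop) (D C r : ℕ) (π : List α) : Prop :=
  ∃ J ⊆ Finset.range r, r ≤ 4 * J.card ∧ ∃ z y : ℕ → List β,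
    (∀ j ∈ J, (z j).length ≤ C ∧ (y j).length ≤ C) ∧
    (∀ T ⊆ J, A ((pieces D π z y T r).flatMap (Piece.out ι))) ∧
    ∀ j ∈ J, ∀ i ≤ j,
      ¬ K (((List.range' i (j - i)).flatMap (block D π)).map ι ++ z j) ∧
      K (((List.range' i (j - i)).flatMap (block D π)).map ι ++ (z j).dropLast)

lemma marked_pieces {ι : α → β} {K : List β → Prop} {D r : ℕ} {π : List α} {z y : ℕ → List β}
    {T : Finset ℕ}
    (h : ∀ j ∈ T, ∀ i ≤ j,
      ¬ K (((List.range' i (j - i)).flatMap (block D π)).map ι ++ z j) ∧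
      K (((List.range' i (j - i)).flatMap (block D π)).map ι ++ (z j).dropLast)) :
    Marked ι K (pieces D π z y T r) := by
  intro P g Y hs
  rw [List.suffix_iff_eq_drop] at hs
  set i := (pieces D π z y T r).length - (P.map Sum.inl ++ Sum.inr g :: Y).length with hi
  have hget : ∀ k, (P.map Sum.inl ++ Sum.inr g :: Y)[k]? = (pieces D π z y T r)[i + k]? := by
    intro k; rw [hs, List.getElem?_drop]
  have hp : ∀ k x, (pieces D π z y T r)[k]? = some x →
      x = if k ∈ T then Sum.inr (block D π k, z k, y k) else Sum.inl (block D π k) := by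
    intro k x hk
    simp only [pieces, List.getElem?_map, Option.map_eq_some_iff] at hk
    obtain ⟨k', hk', rfl⟩ := hk
    obtain ⟨hlt, rfl⟩ := List.getElem?_eq_some_iff.1 hk'
    simp
  have hg := hp (i + P.length) (Sum.inr g) (by rw [← hget]; simp)
  have hgT : i + P.length ∈ T := by
    by_contra h'
    rw [if_neg h'] at hg
    exact Sum.inr_ne_inl hg
  rw [if_pos hgT] at hg
  have hg := Sum.inr_injective hg
  have hP : P = (List.range' i P.length).map (block D π) := by
    refine List.ext_getElem (by simp) fun k hk _ => ?_
    have := hp (i + k) (Sum.inl P[k]) (by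
      rw [← hget, List.getElem?_append_left (by simpa using hk)]; simp [hk])
    split_ifs at this
    simpa using Sum.inl_injective this
  have := h _ hgT i (by omega)
  rw [Nat.add_sub_cancel_left] at this
  have e : P.flatten = (List.range' i P.length).flatMap (block D π) := by
    conv_lhs => rw [hP]
    rw [List.flatMap_def]
  rw [hg, e]
  exact this

lemma replaced_pieces (D : ℕ) (π : List α) (z y : ℕ → List β) (T : Finset ℕ) (r : ℕ) :
    replaced (pieces D π z y T r) =
      ((List.range r).filter (· ∈ T)).map fun j => (block D π j, z j, y j) := by
  rw [replaced, pieces, List.filterMap_map]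
  induction List.range r with
  | nil => rfl
  | cons a l ih =>
    by_cases h : a ∈ T
    · simp [h] at ih ⊢; exact ih
    · simp [h] at ih ⊢; exact ih

lemma length_filter_range {T : Finset ℕ} {r : ℕ} (hT : T ⊆ Finset.range r) :
    ((List.range r).filter (· ∈ T)).length = T.card := by
  rw [← List.toFinset_card_of_nodup (List.nodup_range.filter _)]
  congr 1
  ext j
  simp only [List.mem_toFinset, List.mem_filter, List.mem_range, decide_eq_true_eq]
  exact ⟨fun h => h.2, fun h => ⟨Finset.mem_range.1 (hT h), h⟩⟩

lemma length_out_pieces_le {ι : α → β} {D C r : ℕ} {π : List α} {z y : ℕ → List β} {T : Finset ℕ}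
    (hT : T ⊆ Finset.range r) (hzy : ∀ j ∈ T, (z j).length ≤ C ∧ (y j).length ≤ C) :
    ((pieces D π z y T r).flatMap (Piece.out ι)).length ≤ D * r + 2 * C * T.card := by
  rw [← length_filter_range hT, pieces, List.flatMap_map]
  have : D * r = D * (List.range r).length := by simp
  rw [this]
  induction List.range r with
  | nil => simp
  | cons a l ih =>
    have hb : (block D π a).length ≤ D := by simp [block]
    by_cases h : a ∈ T
    · have := hzy a h
      simp only [h, List.flatMap_cons, if_true, List.length_append, List.length_cons,
        List.filter_cons, decide_true, Piece.out, Sum.elim_inr, mul_add, mul_one]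
      simp only [Piece.out] at ih
      omega
    · simp only [h, List.flatMap_cons, if_false, List.length_append, List.length_cons,
        List.filter_cons, decide_false, Piece.out, Sum.elim_inl, mul_add, mul_one,
        List.length_map, Bool.false_eq_true]
      simp only [Piece.out] at ih
      omega

lemma pieces_injective {D r : ℕ} {π π' : List α} {z y z' y' : ℕ → List β} {T T' : Finset ℕ}
    (hπ : π.length = D * r) (hπ' : π'.length = D * r) (hT : T ⊆ Finset.range r)
    (hT' : T' ⊆ Finset.range r) (h : pieces D π z y T r = pieces D π' z' y' T' r) :
    π = π' ∧ T = T' := by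
  have key : ∀ j < r,
      (if j ∈ T then (Sum.inr (block D π j, z j, y j) : Piece α β) else Sum.inl (block D π j)) =
      (if j ∈ T' then Sum.inr (block D π' j, z' j, y' j) else Sum.inl (block D π' j)) := by
    intro j hj
    exact List.map_inj_left.1 h j (List.mem_range.2 hj)
  have hmem : ∀ j < r, (j ∈ T ↔ j ∈ T') := by
    intro j hj
    have := key j hj
    by_cases h1 : j ∈ T <;> by_cases h2 : j ∈ T' <;> simp [h1, h2] at this ⊢
  refine ⟨eq_of_block_eq hπ hπ' fun j hj => ?_, ?_⟩
  · have := key j hj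
    by_cases h1 : j ∈ T
    · have h2 := (hmem j hj).1 h1
      simp [h1, h2] at this
      exact this.1
    · have h2 : j ∉ T' := fun h2 => h1 ((hmem j hj).2 h2)
      rw [if_neg h1, if_neg h2] at this
      exact Sum.inl_injective this
  · ext j
    constructor
    · exact fun hj => (hmem j (Finset.mem_range.1 (hT hj))).1 hj
    · exact fun hj => (hmem j (Finset.mem_range.1 (hT' hj))).2 hj

open Classical in
/-- The words of length `n` with property `A`. -/
noncomputable def wordsWith [Finite β] (A : List β → Prop) (n : ℕ) : Finset (List β) :=
  (List.finite_length_eq β n).toFinset.filter A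

lemma mem_wordsWith [Finite β] {A : List β → Prop} {n : ℕ} {w : List β} :
    w ∈ wordsWith A n ↔ w.length = n ∧ A w := by
  simp [wordsWith]

end WordWalk

/-! ### Rewritable words force a strictly larger growth rate. -/

namespace WordWalk

variable {α β Γ H : Type*} [Group Γ] [Group H]

/-- The lists of length `k` with entries in `S`. -/
def listsOf {δ : Type*} [DecidableEq δ] (S : Finset δ) (k : ℕ) : Finset (List δ) :=
  (Fintype.piFinset fun _ : Fin k => S).image List.ofFn

lemma card_listsOf_le {δ : Type*} [DecidableEq δ] (S : Finset δ) (k : ℕ) :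
    (listsOf S k).card ≤ S.card ^ k := by
  refine Finset.card_image_le.trans ?_
  simp

lemma mem_listsOf {δ : Type*} [DecidableEq δ] {S : Finset δ} {l : List δ}
    (h : ∀ x ∈ l, x ∈ S) : l ∈ listsOf S l.length :=
  Finset.mem_image.2 ⟨l.get, Fintype.mem_piFinset.2 fun _ => h _ (List.get_mem _ _),
    List.ofFn_get l⟩

open Classical in
/-- The possible replacements of a block of length `D` by two words of length at most `C`. -/
noncomputable def replacements (α β : Type*) [Finite α] [Finite β] (D C : ℕ) :
    Finset (List α × List β × List β) :=
  (List.finite_length_eq α D).toFinset ×ˢ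
    ((List.finite_length_le β C).toFinset ×ˢ (List.finite_length_le β C).toFinset)

-- A pair of a word `π` and a set `T` of `k` blocks is sent to the rewritten word and the list of
-- its replacements. By `Marked.ext` this is injective; there are boundedly many replacements, so
-- the list costs only a factor exponential in `k`.
open Classical in
lemma card_rewritings_le [Finite α] [Finite β] {ι : α → β} (hι : Function.Injective ι)
    {K A : List β → Prop} (hK : ∀ u v, u <+: v → K v → K u) {D C r : ℕ} (hD : 0 < D)
    (G : Finset (List α)) (hG : ∀ π ∈ G, π.length = D * r) (J : List α → Finset ℕ)
    (z y : List α → ℕ → List β) (hJ : ∀ π ∈ G, J π ⊆ Finset.range r)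
    (hlen : ∀ π ∈ G, ∀ j ∈ J π, (z π j).length ≤ C ∧ (y π j).length ≤ C)
    (hA : ∀ π ∈ G, ∀ T ⊆ J π, A ((pieces D π (z π) (y π) T r).flatMap (Piece.out ι)))
    (hmark : ∀ π ∈ G, ∀ j ∈ J π, ∀ i ≤ j,
      ¬ K (((List.range' i (j - i)).flatMap (block D π)).map ι ++ z π j) ∧
      K (((List.range' i (j - i)).flatMap (block D π)).map ι ++ (z π j).dropLast)) (k : ℕ) :
    ((G.sigma fun π => (J π).powerset).filter fun x => x.2.card = k).card ≤
      (∑ n ∈ Finset.range (D * r + 2 * C * k + 1), (wordsWith A n).card) *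
        (replacements α β D C).card ^ k := by
  set W : (Σ _ : List α, Finset ℕ) → List (Piece α β) :=
    fun x => pieces D x.1 (z x.1) (y x.1) x.2 r with hW
  have hX : ∀ x ∈ (G.sigma fun π => (J π).powerset).filter fun x => x.2.card = k,
      x.1 ∈ G ∧ x.2 ⊆ J x.1 ∧ x.2.card = k := by
    intro x hx
    simpa [and_assoc] using hx
  calc _ ≤ (((Finset.range (D * r + 2 * C * k + 1)).biUnion (wordsWith A)) ×ˢ
        listsOf (replacements α β D C) k).card := by
        refine Finset.card_le_card_of_injOn
          (fun x => ((W x).flatMap (Piece.out ι), replaced (W x))) ?_ ?_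
        · intro x hx
          obtain ⟨hxG, hxJ, hxk⟩ := hX x hx
          have hxr := hxJ.trans (hJ _ hxG)
          simp only [Finset.coe_product, Set.mem_prod, Finset.mem_coe]
          constructor
          · refine Finset.mem_biUnion.2 ⟨_, ?_, mem_wordsWith.2 ⟨rfl, hA _ hxG _ hxJ⟩⟩
            have := length_out_pieces_le (ι := ι) (D := D) (π := x.1) hxr
              fun j hj => hlen _ hxG j (hxJ hj)
            rw [hxk] at this
            exact Finset.mem_range.2 (by simp only [hW]; omega)
          · have e : (replaced (W x)).length = k := by
              rw [hW, replaced_pieces, List.length_map, length_filter_range hxr, hxk]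
            rw [← e]
            refine mem_listsOf fun g hg => ?_
            rw [hW, replaced_pieces] at hg
            obtain ⟨j, hj, rfl⟩ := List.mem_map.1 hg
            have hjT : j ∈ x.2 := by simpa using (List.mem_filter.1 hj).2
            have hjr : j < r := Finset.mem_range.1 (hxr hjT)
            have := hlen _ hxG j (hxJ hjT)
            simp only [replacements, Finset.mem_product, Set.Finite.mem_toFinset,
              Set.mem_ofPred_eq]
            exact ⟨length_block (hG _ hxG) hjr, this.1, this.2⟩
        · intro x hx x' hx' e
          obtain ⟨hxG, hxJ, hxk⟩ := hX x hx
          obtain ⟨hxG', hxJ', hxk'⟩ := hX x' hx'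
          have hpl : ∀ x : (Σ _ : List α, Finset ℕ), x.1 ∈ G → ∀ b, Sum.inl b ∈ W x →
              b.length = D := by
            intro x hxG b hb
            obtain ⟨j, hj, e⟩ := List.mem_map.1 hb
            split_ifs at e
            rw [← Sum.inl_injective e]
            exact length_block (hG _ hxG) (List.mem_range.1 hj)
          have := Marked.ext hι hK hD (marked_pieces fun j hj => hmark _ hxG j (hxJ hj))
            (marked_pieces fun j hj => hmark _ hxG' j (hxJ' hj)) (hpl x hxG) (hpl x' hxG')
            (Prod.mk.inj e).1 (Prod.mk.inj e).2
          obtain ⟨h1, h2⟩ := pieces_injective (hG _ hxG) (hG _ hxG') (hxJ.trans (hJ _ hxG))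
            (hxJ'.trans (hJ _ hxG')) this
          exact Sigma.ext h1 (heq_of_eq h2)
    _ ≤ _ := by
        rw [Finset.card_product]
        exact Nat.mul_le_mul Finset.card_biUnion_le (card_listsOf_le _ _)

lemma exists_one_lt_pow_lt (n : ℕ) {a : ℝ} (ha : 1 < a) : ∃ ξ : ℝ, 1 < ξ ∧ ξ < 2 ∧ ξ ^ n < a := by
  have h : Tendsto (fun ξ : ℝ => ξ ^ n) (𝓝[>] 1) (𝓝 (1 ^ n)) :=
    ((continuous_pow n).tendsto 1).mono_left nhdsWithin_le_nhds
  rw [one_pow] at h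
  obtain ⟨ξ, h1, h2, h3⟩ := ((h.eventually (gt_mem_nhds ha)).and
    ((eventually_mem_nhdsWithin).and (mem_nhdsWithin_of_mem_nhds
      (Iio_mem_nhds (by norm_num : (1 : ℝ) < 2))))).exists
  exact ⟨ξ, h2, h3, h1⟩

/-- If a language has many rewritable words, then the language of the rewritten words grows
strictly faster. -/
theorem not_growthLE_of_rewritable [Finite α] [Finite β] {ι : α → β}
    (hι : Function.Injective ι) {K A : List β → Prop} (hK : ∀ u v, u <+: v → K v → K u)
    {l : ℝ} (hl : 1 ≤ l) {D C : ℕ} (hD : 0 < D)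
    (h : ∀ x : ℝ, 0 < x → x < l → ∃ᶠ r in atTop, ∃ G : Finset (List α),
      x ^ (D * r) < (G.card : ℝ) ∧ ∀ π ∈ G, π.length = D * r ∧ Rewritable ι K A D C r π) :
    ¬ GrowthLE (fun n => (wordsWith A n).card) l := by
  classical
  intro hgr
  set M : ℝ := (replacements α β D C).card + 1 with hM
  have hM0 : 0 < M := by positivity
  -- Weight of a replaced block: it pays for the choice of the replacement (`M`) and for at most `2
  -- * C` additional letters, each of cost `Y ≤ 2 * l`.
  set θ : ℝ := 1 / (M * (2 * l) ^ (2 * C)) with hθ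
  have hθ0 : 0 < θ := by positivity
  -- Gain per block: the subsets of `J π` have total weight `(1 + θ) ^ (J π).card`, and `J π`
  -- contains at least a quarter of the blocks.
  set η : ℝ := (1 + θ) ^ (1 / 4 : ℝ) with hη
  have hη1 : 1 < η := Real.one_lt_rpow (by linarith) (by norm_num)
  have hη4 : η ^ 4 = 1 + θ := by
    rw [hη, ← Real.rpow_natCast, ← Real.rpow_mul (by linarith)]
    norm_num
  -- The number of original words is known only up to rate `l / ξ` and that of outputs up to rate `l
  -- * ξ`. The loss per block, `ξ ^ (2 * D)`, must stay below the gain `η`.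
  obtain ⟨ξ, hξ1, hξ2, hξη⟩ := exists_one_lt_pow_lt (2 * D) hη1
  have hξ0 : 0 < ξ := by linarith
  have hx : l / ξ < l := div_lt_self (by linarith) hξ1
  have hx0 : 0 < l / ξ := by positivity
  obtain ⟨Y, hYdef⟩ : ∃ Y, Y = l * ξ := ⟨_, rfl⟩
  have hy : Y > l := by nlinarith
  have hy1 : 1 ≤ Y := by linarith
  have hy0 : 0 < Y := by linarith
  have hy2 : Y ≤ 2 * l := by nlinarith
  obtain ⟨c, hc, hcy⟩ := hgr Y hy
  have hq0 : 0 ≤ ξ ^ (2 * D) / η := by positivity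
  have hq1 : ξ ^ (2 * D) / η < 1 := by rwa [div_lt_one (by linarith)]
  -- The polynomial factor counts the possible sizes of `T` and the possible output lengths; the
  -- exponential decay beats it.
  have hlim : Tendsto (fun r : ℕ => (4 * (D + 2 * C + 1) * c) *
      ((r : ℝ) ^ 2 * (ξ ^ (2 * D) / η) ^ r)) atTop (𝓝 ((4 * (D + 2 * C + 1) * c) * 0)) :=
    (tendsto_pow_const_mul_const_pow_of_abs_lt_one 2
      (by rwa [abs_of_nonneg hq0])).const_mul _
  rw [mul_zero] at hlim
  obtain ⟨r, ⟨G, hGx, hG⟩, hr1, hr⟩ := ((h _ hx0 hx).and_eventually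
    ((eventually_ge_atTop 1).and (hlim.eventually (gt_mem_nhds one_pos)))).exists
  have hG' : ∀ π ∈ G, Rewritable ι K A D C r π := fun π hπ => (hG π hπ).2
  unfold Rewritable at hG'
  choose! J hJ hJc z y hlen hA hmark using hG'
  have hcount := card_rewritings_le hι hK hD G (fun π hπ => (hG π hπ).1) J z y hJ hlen hA hmark
  set X := G.sigma fun π => (J π).powerset with hXdef
  have hlow : (G.card : ℝ) * η ^ r ≤ ∑ x ∈ X, θ ^ x.2.card := by
    rw [hXdef, Finset.sum_sigma, ← nsmul_eq_mul, ← Finset.sum_const]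
    refine Finset.sum_le_sum fun π hπ => ?_
    have e : ∑ T ∈ (J π).powerset, θ ^ T.card = (θ + 1) ^ (J π).card := by
      rw [← Finset.sum_pow_mul_eq_add_pow]
      simp
    dsimp only
    rw [e, add_comm, ← hη4, ← pow_mul]
    exact pow_le_pow_right₀ hη1.le (hJc π hπ)
  have hup : ∑ x ∈ X, θ ^ x.2.card ≤
      (r + 1) * ((D * r + 2 * C * r + 1) * (c * Y ^ (D * r))) := by
    have hmaps : ∀ x ∈ X, x.2.card ∈ Finset.range (r + 1) := by
      intro x hx
      simp only [hXdef, Finset.mem_sigma, Finset.mem_powerset] at hx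
      have := Finset.card_le_card (hx.2.trans (hJ _ hx.1))
      rw [Finset.card_range] at this
      exact Finset.mem_range.2 (by omega)
    rw [← Finset.sum_fiberwise_of_maps_to hmaps]
    have hk : ∀ k ∈ Finset.range (r + 1), ∑ x ∈ X with x.2.card = k, θ ^ x.2.card ≤
        (D * r + 2 * C * r + 1) * (c * Y ^ (D * r)) := by
      intro k hk
      have hkr : k ≤ r := by simpa [Nat.lt_succ_iff] using hk
      have hkr' : (k : ℝ) ≤ r := by exact_mod_cast hkr
      rw [Finset.sum_congr rfl fun x hx => by rw [(Finset.mem_filter.1 hx).2], Finset.sum_const,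
        nsmul_eq_mul]
      have h1 : ((X.filter fun x => x.2.card = k).card : ℝ) ≤
          (∑ n ∈ Finset.range (D * r + 2 * C * k + 1), ((wordsWith A n).card : ℝ)) *
            ((replacements α β D C).card : ℝ) ^ k := by exact_mod_cast hcount k
      have h2 : ∑ n ∈ Finset.range (D * r + 2 * C * k + 1), ((wordsWith A n).card : ℝ) ≤
          (D * r + 2 * C * k + 1) * (c * Y ^ (D * r + 2 * C * k)) := by
        calc _ ≤ ∑ n ∈ Finset.range (D * r + 2 * C * k + 1),
              c * Y ^ (D * r + 2 * C * k) := by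
              refine Finset.sum_le_sum fun n hn => (hcy n).trans ?_
              have := Finset.mem_range.1 hn
              gcongr
              omega
          _ = _ := by simp
      have h3 : ((replacements α β D C).card : ℝ) ^ k ≤ M ^ k := by
        gcongr; linarith
      have h4 : θ * M * Y ^ (2 * C) ≤ 1 := by
        have : Y ^ (2 * C) ≤ (2 * l) ^ (2 * C) := by
          gcongr
        calc θ * M * Y ^ (2 * C) ≤ θ * M * (2 * l) ^ (2 * C) := by gcongr
          _ = 1 := by rw [hθ]; field_simp
      calc ((X.filter fun x => x.2.card = k).card : ℝ) * θ ^ k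
          ≤ ((D * r + 2 * C * k + 1) * (c * Y ^ (D * r + 2 * C * k)) * M ^ k) * θ ^ k := by
            gcongr
            exact h1.trans (by gcongr)
        _ = (D * r + 2 * C * k + 1) * (c * Y ^ (D * r)) *
              (θ * M * Y ^ (2 * C)) ^ k := by
            rw [mul_pow, mul_pow, pow_add, pow_mul Y (2 * C) k]; ring
        _ ≤ (D * r + 2 * C * k + 1) * (c * Y ^ (D * r)) * 1 := by
            gcongr
            exact pow_le_one₀ (by positivity) h4
        _ ≤ (D * r + 2 * C * r + 1) * (c * Y ^ (D * r)) := by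
            rw [mul_one]; gcongr
    calc _ ≤ ∑ k ∈ Finset.range (r + 1), (D * r + 2 * C * r + 1) * (c * Y ^ (D * r)) :=
          Finset.sum_le_sum hk
      _ = _ := by simp
  have hr1' : (1 : ℝ) ≤ r := by exact_mod_cast hr1
  have hηr : 0 < η ^ r := by positivity
  have hfin : (l / ξ) ^ (D * r) * η ^ r <
      (r + 1) * ((D * r + 2 * C * r + 1) * (c * Y ^ (D * r))) :=
    (mul_lt_mul_of_pos_right hGx hηr).trans_le (hlow.trans hup)
  have hpoly : ((r : ℝ) + 1) * (D * r + 2 * C * r + 1) ≤ 4 * (D + 2 * C + 1) * (r : ℝ) ^ 2 := by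
    have h1 : (r : ℝ) + 1 ≤ 2 * r := by linarith
    have h2 : (D : ℝ) * r + 2 * C * r + 1 ≤ 2 * (D + 2 * C + 1) * r := by
      have : 0 ≤ (D : ℝ) * r := by positivity
      have : 0 ≤ (C : ℝ) * r := by positivity
      nlinarith
    calc ((r : ℝ) + 1) * (D * r + 2 * C * r + 1)
        ≤ (2 * r) * (2 * (D + 2 * C + 1) * r) := by gcongr
      _ = _ := by ring
  have hlp : 0 < (l / ξ) ^ (D * r) * η ^ r := by positivity
  have : (l / ξ) ^ (D * r) * η ^ r <
      (l / ξ) ^ (D * r) * η ^ r *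
        ((4 * (D + 2 * C + 1) * c) * ((r : ℝ) ^ 2 * (ξ ^ (2 * D) / η) ^ r)) := by
    refine hfin.trans_le ?_
    have e : (l / ξ) ^ (D * r) * η ^ r * (ξ ^ (2 * D) / η) ^ r = Y ^ (D * r) := by
      rw [hYdef, div_pow, div_pow, mul_pow, ← pow_mul, show 2 * D * r = D * r + D * r by ring, pow_add]
      field_simp
    calc ((r : ℝ) + 1) * ((D * r + 2 * C * r + 1) * (c * Y ^ (D * r)))
        = (((r : ℝ) + 1) * (D * r + 2 * C * r + 1)) * (c * Y ^ (D * r)) := by ring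
      _ ≤ (4 * (D + 2 * C + 1) * (r : ℝ) ^ 2) * (c * Y ^ (D * r)) := by gcongr
      _ = _ := by rw [← e]; ring
  have hlt := mul_lt_mul_of_pos_left hr hlp
  rw [mul_one] at hlt
  linarith

end WordWalk

/-! ### Ears and detours: simultaneous local changes of a walk. -/

namespace WordWalk

variable {α β Γ H : Type*} [Group Γ] [Group H]

/-- Different chunks cannot meet because their images in `H` lie in the disjoint cells `V j`; `g j`
is the image of the starting point of chunk `j`. Within a chunk, avoidance is needed only in `Γ`. -/
lemma avoiding_flatMap_range {f : Γ →* H} {φ : β → Γ} {c : ℕ → List β} {V : ℕ → Set H}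
    {g : ℕ → H} (g_zero : g 0 = 1) (r : ℕ) (hav : ∀ j < r, Avoiding φ (c j))
    (hg : ∀ j < r, g j * f ((c j).map φ).prod = g (j + 1))
    (hV : ∀ j < r, ∀ i < (c j).length, g j * f (pos φ (c j) i) ∈ V j)
    (hdis : ∀ i < r, ∀ j < r, i ≠ j → Disjoint (V i) (V j)) :
    Avoiding φ ((List.range r).flatMap c) := by
  suffices h : ∀ k ≤ r, Avoiding φ ((List.range k).flatMap c) ∧
      f (((List.range k).flatMap c).map φ).prod = g k ∧
      ∀ i < ((List.range k).flatMap c).length, ∃ j < k,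
        f (pos φ ((List.range k).flatMap c) i) ∈ V j from (h r le_rfl).1
  intro k
  induction k with
  | zero => exact fun _ => ⟨by simpa using avoiding_nil φ, by simp [g_zero], by simp⟩
  | succ k ih =>
    intro hk
    obtain ⟨h1, h2, h3⟩ := ih (by omega)
    rw [List.range_succ, List.flatMap_append, List.flatMap_singleton]
    set u := (List.range k).flatMap c with hu
    refine ⟨avoiding_append.2 ⟨h1, hav k (by omega), fun i i' hi hi' e => ?_⟩, ?_, ?_⟩
    · obtain ⟨j, hj, hj'⟩ := h3 i hi
      have h4 := hV k (by omega) i' hi'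
      rw [← h2, ← map_mul, ← e] at h4
      exact Set.disjoint_left.1 (hdis j (by omega) k (by omega) (by omega)) hj' h4
    · rw [List.map_append, List.prod_append, map_mul, h2, hg k (by omega)]
    · intro i hi
      rw [List.length_append] at hi
      rcases lt_or_ge i u.length with h | h
      · obtain ⟨j, hj, hj'⟩ := h3 i h
        exact ⟨j, by omega, by rwa [pos_append_of_le φ _ h.le]⟩
      · obtain ⟨i', rfl⟩ := Nat.exists_eq_add_of_le h
        refine ⟨k, by omega, ?_⟩
        rw [pos_append_add, map_mul, h2]
        exact hV k (by omega) i' (by omega)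

lemma pos_map_take_append (φ : β → Γ) (ι : α → β) {b : List α} {s : ℕ} (hs : s ≤ b.length)
    (v : List β) (k : ℕ) :
    pos φ ((b.take s).map ι ++ v) (s + k) = pos (φ ∘ ι) b s * pos φ v k := by
  have h := pos_append_add φ ((b.take s).map ι) v k
  rwa [List.length_map, List.length_take, min_eq_left hs, List.map_map, prod_take] at h

/-- Replace the part of `b` between the times `s` and `t` by `z`; if `t ≤ s`, go back from
time `s` to time `t` along `z` and repeat the part of `b` between these times. -/
def splice (ι : α → β) (b : List α) (s t : ℕ) (z : List β) : List β :=
  (b.take s).map ι ++ z ++ (b.drop t).map ι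

/-- The interior of `z` misses `b` even in `H`. The only remaining danger is `t ≤ s`, when the part
of `b` between `t` and `s` is walked twice. In `H` the two passes coincide, but in `Γ` corresponding
vertices differ by `hover`. -/
lemma avoiding_splice {f : Γ →* H} {φ : β → Γ} {ι : α → β} {b : List α}
    (hb : Avoiding (f ∘ φ ∘ ι) b) {s t : ℕ} (hs : s < b.length) (ht : t < b.length)
    {z : List β} (hz : Avoiding (f ∘ φ) z)
    (hclose : f (pos (φ ∘ ι) b s * (z.map φ).prod) = f (pos (φ ∘ ι) b t))
    (hover : t ≤ s → pos (φ ∘ ι) b s * (z.map φ).prod ≠ pos (φ ∘ ι) b t)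
    (hin : ∀ i, 0 < i → i < z.length → ∀ t' < b.length,
      f (pos (φ ∘ ι) b s * pos φ z i) ≠ f (pos (φ ∘ ι) b t')) :
    Avoiding φ (splice ι b s t z) := by
  have hfb : ∀ i j, i < b.length → j < b.length →
      f (pos (φ ∘ ι) b i) = f (pos (φ ∘ ι) b j) → i = j := by
    intro i j hi hj e
    rw [map_pos, map_pos] at e
    exact hb.eq hi hj e
  have hb' : Avoiding (φ ∘ ι) b := hb.of_comp
  have hz' : Avoiding φ z := hz.of_comp
  rw [splice, avoiding_append, avoiding_append]
  refine ⟨⟨avoiding_map.2 (hb'.take s), hz', ?_⟩, avoiding_map.2 (hb'.drop t), ?_⟩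
  · intro i j hi hj e
    simp only [List.length_map, List.length_take, lt_min_iff] at hi
    rw [pos_map, pos_take _ _ hi.1.le, List.map_map, prod_take] at e
    rcases Nat.eq_zero_or_pos j with rfl | hj0
    · rw [pos_zero, mul_one] at e
      have := hb'.eq hi.2 hs e
      omega
    · exact hin j hj0 hj i hi.2 (by rw [← e])
  · intro i j hi hj e
    simp only [List.length_map, List.length_drop] at hj
    rw [List.length_append, List.length_map, List.length_take, min_eq_left hs.le] at hi
    rw [List.map_append, List.prod_append, List.map_map, prod_take, pos_map] at e
    have e' := congrArg f e
    rw [map_mul f (_ * _), hclose, ← map_mul, ← pos_add] at e'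
    rcases lt_or_ge i s with h | h
    · rw [pos_append_of_le _ _ (by simp; omega), pos_map, pos_take _ _ h.le] at e e'
      have h1 := hfb _ _ (by omega) (by omega) e'
      refine hover (by omega) ?_
      exact mul_right_cancel (e.symm.trans ((congrArg _ h1).trans (pos_add _ _ _ _)))
    · obtain ⟨k, rfl⟩ := Nat.exists_eq_add_of_le h
      rw [pos_map_take_append _ _ hs.le] at e e'
      rcases Nat.eq_zero_or_pos k with rfl | hk
      · rw [pos_zero, mul_one] at e e'
        have h1 := hfb _ _ hs (by omega) e'
        refine hover (by omega) ?_
        exact mul_right_cancel (e.symm.trans ((congrArg _ h1).trans (pos_add _ _ _ _)))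
      · exact hin k hk (by omega) _ (by omega) e'

lemma map_prod_splice {f : Γ →* H} {φ : β → Γ} {ι : α → β} {b : List α} {s t : ℕ} {z : List β}
    (hclose : f (pos (φ ∘ ι) b s * (z.map φ).prod) = f (pos (φ ∘ ι) b t)) :
    f ((splice ι b s t z).map φ).prod = f (b.map (φ ∘ ι)).prod := by
  rw [splice, List.map_append, List.map_append, List.prod_append, List.prod_append, List.map_map,
    List.map_map, prod_take, map_mul, hclose, ← map_mul, pos_mul_prod_drop]

lemma map_pos_splice {f : Γ →* H} {φ : β → Γ} {ι : α → β} {b : List α} {s t : ℕ}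
    (hs : s < b.length) {z : List β}
    (hclose : f (pos (φ ∘ ι) b s * (z.map φ).prod) = f (pos (φ ∘ ι) b t)) {i : ℕ}
    (hi : i < (splice ι b s t z).length) :
    (∃ t' < b.length, f (pos φ (splice ι b s t z) i) = f (pos (φ ∘ ι) b t')) ∨
    ∃ k, 0 < k ∧ k < z.length ∧
      f (pos φ (splice ι b s t z) i) = f (pos (φ ∘ ι) b s * pos φ z k) := by
  have hl : ((b.take s).map ι).length = s := by simp; omega
  have hlen : (splice ι b s t z).length = s + z.length + (b.length - t) := by
    simp [splice]; omega
  rw [hlen] at hi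
  rcases lt_or_ge i s with h | h
  · left
    refine ⟨i, by omega, ?_⟩
    rw [splice, List.append_assoc, pos_append_of_le _ _ (by omega), pos_map, pos_take _ _ h.le]
  · obtain ⟨k, rfl⟩ := Nat.exists_eq_add_of_le h
    have e : pos φ (splice ι b s t z) (s + k) =
        pos (φ ∘ ι) b s * pos φ (z ++ (b.drop t).map ι) k := by
      rw [splice, List.append_assoc, pos_map_take_append _ _ hs.le]
    rw [e]
    rcases lt_or_ge k z.length with h' | h'
    · rw [pos_append_of_le _ _ h'.le]
      rcases Nat.eq_zero_or_pos k with rfl | hk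
      · exact Or.inl ⟨s, hs, by simp⟩
      · exact Or.inr ⟨k, hk, h', rfl⟩
    · obtain ⟨m, rfl⟩ := Nat.exists_eq_add_of_le h'
      left
      refine ⟨t + m, by omega, ?_⟩
      rw [pos_append_add, pos_map, ← mul_assoc, map_mul, hclose, ← map_mul, pos_add]

/-- An ear of the walk `π` near its position at time `t₀`: the walk `z` leads from the position at
time `s` to the position at time `t`, up to the kernel of `f`, through vertices that are not
visited by `π`. -/
structure IsEar (f : Γ →* H) (φ : β → Γ) (ι : α → β) (F : Finset H) (C : ℕ) (π : List α)
    (t₀ s t : ℕ) (z : List β) : Prop where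
  lt_left : s < π.length
  lt_right : t < π.length
  length_le : z.length ≤ C
  close : f (pos (φ ∘ ι) π s * (z.map φ).prod) = f (pos (φ ∘ ι) π t)
  avoiding : Avoiding (f ∘ φ) z
  unvisited : ∀ i, 0 < i → i < z.length → ∀ t' < π.length,
    f (pos (φ ∘ ι) π s * pos φ z i) ≠ f (pos (φ ∘ ι) π t')
  near : ∀ i, 0 < i → i < z.length →
    (f (pos (φ ∘ ι) π t₀))⁻¹ * f (pos (φ ∘ ι) π s * pos φ z i) ∈ F
  near_left : (f (pos (φ ∘ ι) π t₀))⁻¹ * f (pos (φ ∘ ι) π s) ∈ F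
  near_right : (f (pos (φ ∘ ι) π t₀))⁻¹ * f (pos (φ ∘ ι) π t) ∈ F

/-- An ear that may be used as a detour: if it leads backwards in time, then it does not close up in
`Γ`. -/
structure IsDetour (f : Γ →* H) (φ : β → Γ) (ι : α → β) (F : Finset H) (C : ℕ) (π : List α)
    (t₀ s t : ℕ) (z : List β) : Prop extends IsEar f φ ι F C π t₀ s t z where
  overlap : t ≤ s → pos (φ ∘ ι) π s * (z.map φ).prod ≠ pos (φ ∘ ι) π t

/-- The formal inverse of a word. -/
def invWord (inv : β → β) (z : List β) : List β := (z.map inv).reverse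

lemma prod_map_invWord {inv : β → β} {φ : β → Γ} (hinv : ∀ b, φ (inv b) = (φ b)⁻¹)
    (z : List β) : ((invWord inv z).map φ).prod = ((z.map φ).prod)⁻¹ := by
  rw [List.prod_inv_reverse, invWord, List.map_reverse, List.map_map, List.map_map]
  congr 2
  refine List.map_congr_left fun b _ => ?_
  simp [hinv]

lemma prod_mul_pos_invWord {inv : β → β} {φ : β → Γ} (hinv : ∀ b, φ (inv b) = (φ b)⁻¹)
    (z : List β) (i : ℕ) :
    (z.map φ).prod * pos φ (invWord inv z) i = pos φ z (z.length - i) := by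
  have e : (invWord inv z).take i = invWord inv (z.drop (z.length - i)) := by
    rw [invWord, List.take_reverse, invWord, List.map_drop, List.length_map]
  rw [pos, e, prod_map_invWord hinv, ← pos_mul_prod_drop φ z (z.length - i), mul_inv_cancel_right]

lemma IsEar.reverse {f : Γ →* H} {φ : β → Γ} {ι : α → β} {F : Finset H} {C : ℕ} {π : List α}
    {t₀ s t : ℕ} {z : List β} (h : IsEar f φ ι F C π t₀ s t z) {inv : β → β}
    (hinv : ∀ b, φ (inv b) = (φ b)⁻¹) : IsEar f φ ι F C π t₀ t s (invWord inv z) := by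
  have hlen : (invWord inv z).length = z.length := by simp [invWord]
  have key : ∀ i, f (pos (φ ∘ ι) π t * pos φ (invWord inv z) i) =
      f (pos (φ ∘ ι) π s * pos φ z (z.length - i)) := by
    intro i
    rw [map_mul, ← h.close, ← map_mul, mul_assoc, prod_mul_pos_invWord hinv]
  refine ⟨h.lt_right, h.lt_left, by rw [hlen]; exact h.length_le, ?_, ?_, ?_, ?_, h.near_right,
    h.near_left⟩
  · have := key z.length
    rwa [Nat.sub_self, pos_zero, mul_one, ← hlen, pos_length] at this
  · intro i j hij hj e
    rw [hlen] at hj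
    have e' : f (pos (φ ∘ ι) π s * pos φ z (z.length - i)) =
        f (pos (φ ∘ ι) π s * pos φ z (z.length - j)) := by
      rw [← key, ← key, map_mul, map_mul, map_pos f φ, map_pos f φ, e]
    rcases Nat.eq_zero_or_pos i with rfl | hi
    · rw [Nat.sub_zero, pos_length, h.close] at e'
      exact h.unvisited _ (by omega) (by omega) _ h.lt_right e'.symm
    · rw [map_mul, map_mul] at e'
      have := mul_left_cancel e'
      rw [map_pos, map_pos] at this
      exact h.avoiding (z.length - j) (z.length - i) (by omega) (by omega) this.symm
  · intro i hi hi'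
    rw [hlen] at hi'
    rw [key]
    exact h.unvisited _ (by omega) (by omega)
  · intro i hi hi'
    rw [hlen] at hi'
    rw [key]
    exact h.near _ (by omega) (by omega)

lemma pos_mod_block (φ : α → Γ) (π : List α) {D s j : ℕ} (hD : 0 < D) (h : s / D = j) :
    pos φ π s = pos φ π (D * j) * pos φ (block D π j) (s % D) := by
  rw [← pos_block φ π j (Nat.mod_lt _ hD).le, ← h, Nat.div_add_mod]

-- The cell of block `j` consists of the vertices that `π` visits during this block and, if `j ∈ J`,
-- of unvisited vertices in the `F`-neighbourhood of the isolated time `t₀ j`. A vertex in two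
-- neighbourhoods of the second kind would make the two isolated times `E`-neighbours, as `E`
-- contains all `g * h⁻¹` with `g, h ∈ F`; isolation then puts them into the same block. Isolation
-- also keeps the endpoints of each detour inside its block.
open Classical in
lemma avoiding_of_detours {f : Γ →* H} {φ : β → Γ} {ι : α → β} {F E : Finset H} {C D r : ℕ}
    (hD : 0 < D) (hFE : ∀ g ∈ F, ∀ h ∈ F, g * h⁻¹ ∈ E) (hF1 : 1 ∈ F) {π : List α}
    (hπ : π.length = D * r) (hav : Avoiding (f ∘ φ ∘ ι) π) {J : Finset ℕ} {t₀ s t : ℕ → ℕ}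
    {z : ℕ → List β}
    (ht : ∀ j ∈ J, t₀ j < π.length ∧ t₀ j / D = j ∧ Isolated (f ∘ φ ∘ ι) E D π (t₀ j) ∧
      IsDetour f φ ι F C π (t₀ j) (s j) (t j) (z j))
    {T : Finset ℕ} (hT : T ⊆ J) :
    Avoiding φ ((List.range r).flatMap fun j =>
      if j ∈ T then splice ι (block D π j) (s j % D) (t j % D) (z j)
      else (block D π j).map ι) := by
  have hFE' : ∀ g ∈ F, g ∈ E := fun g hg => by simpa using hFE g hg 1 hF1
  have hdiv : ∀ j ∈ J, s j / D = j ∧ t j / D = j := by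
    intro j hj
    obtain ⟨h1, h2, h3, h4⟩ := ht j hj
    constructor
    · refine (h3 _ h4.lt_left (hFE' _ ?_)).trans h2
      rw [← map_pos, ← map_pos]; exact h4.near_left
    · refine (h3 _ h4.lt_right (hFE' _ ?_)).trans h2
      rw [← map_pos, ← map_pos]; exact h4.near_right
  have hmul : ∀ j < r, ∀ i < D, D * j + i < π.length := by
    intro j hj i hi
    have : D * (j + 1) ≤ D * r := Nat.mul_le_mul_left _ hj
    rw [mul_add, mul_one] at this
    omega
  have hdivadd : ∀ j, ∀ i < D, (D * j + i) / D = j := by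
    intro j i hi
    rw [Nat.mul_add_div hD, Nat.div_eq_of_lt hi, add_zero]
  have hlb : ∀ j < r, (block D π j).length = D := fun j hj => length_block hπ hj
  have hclose : ∀ j ∈ J, f (pos (φ ∘ ι) (block D π j) (s j % D) * ((z j).map φ).prod) =
      f (pos (φ ∘ ι) (block D π j) (t j % D)) := by
    intro j hj
    obtain ⟨h1, h2, h3, h4⟩ := ht j hj
    have := h4.close
    rw [pos_mod_block _ π hD (hdiv j hj).1, pos_mod_block _ π hD (hdiv j hj).2, mul_assoc,
      map_mul, map_mul f _ (pos _ _ (t j % D))] at this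
    exact mul_left_cancel this
  refine avoiding_flatMap_range (f := f) (g := fun j => f (pos (φ ∘ ι) π (D * j)))
    (V := fun j => {h | ∃ t' < π.length, t' / D = j ∧ h = f (pos (φ ∘ ι) π t')} ∪
      {h | j ∈ J ∧ (∀ t' < π.length, h ≠ f (pos (φ ∘ ι) π t')) ∧
        (f (pos (φ ∘ ι) π (t₀ j)))⁻¹ * h ∈ F}) (by simp) r ?_ ?_ ?_ ?_
  · intro j hj
    split_ifs with hjT
    · obtain ⟨h1, h2, h3, h4⟩ := ht j (hT hjT)
      have hd := hdiv j (hT hjT)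
      refine avoiding_splice (hav.block _ _) (by rw [hlb j hj]; exact Nat.mod_lt _ hD)
        (by rw [hlb j hj]; exact Nat.mod_lt _ hD) h4.avoiding (hclose j (hT hjT)) ?_ ?_
      · intro hle e
        refine h4.overlap ?_ ?_
        · rw [← Nat.div_add_mod (s j) D, ← Nat.div_add_mod (t j) D, hd.1, hd.2]
          omega
        · rw [pos_mod_block _ π hD hd.1, pos_mod_block _ π hD hd.2, mul_assoc, e]
      · intro i hi0 hi t' ht' e
        rw [hlb j hj] at ht'
        refine h4.unvisited i hi0 hi (D * j + t') (hmul j hj t' ht') ?_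
        rw [pos_mod_block _ π hD hd.1, pos_block _ π j ht'.le, mul_assoc, map_mul,
          map_mul f _ (pos _ _ t'), e]
    · exact avoiding_map.2 (Avoiding.of_comp (f := f) (hav.block _ _))
  · intro j hj
    have e : pos (φ ∘ ι) π (D * (j + 1)) =
        pos (φ ∘ ι) π (D * j) * ((block D π j).map (φ ∘ ι)).prod := by
      rw [mul_add, mul_one, pos_block _ π j le_rfl, ← pos_length, hlb j hj]
    rw [e, map_mul]
    congr 1
    split_ifs with hjT
    · exact map_prod_splice (hclose j (hT hjT))
    · rw [List.map_map]
  · intro j hj i hi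
    split_ifs at hi ⊢ with hjT
    · obtain ⟨h1, h2, h3, h4⟩ := ht j (hT hjT)
      have hd := hdiv j (hT hjT)
      rcases map_pos_splice (by rw [hlb j hj]; exact Nat.mod_lt _ hD) (hclose j (hT hjT)) hi with
        ⟨t', ht', e⟩ | ⟨k, hk0, hk, e⟩
      · rw [hlb j hj] at ht'
        refine Or.inl ⟨D * j + t', hmul j hj _ ht', hdivadd j _ ht', ?_⟩
        rw [e, pos_block _ π j ht'.le, map_mul]
      · have e' : f (pos (φ ∘ ι) π (D * j)) * f (pos φ (splice ι (block D π j) (s j % D)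
            (t j % D) (z j)) i) = f (pos (φ ∘ ι) π (s j) * pos φ (z j) k) := by
          rw [e, ← map_mul, ← mul_assoc, ← pos_mod_block _ π hD hd.1]
        refine Or.inr ⟨hT hjT, ?_, ?_⟩
        · intro t' ht'
          rw [e']
          exact h4.unvisited k hk0 hk t' ht'
        · rw [e']
          exact h4.near k hk0 hk
    · rw [List.length_map, hlb j hj] at hi
      refine Or.inl ⟨D * j + i, hmul j hj _ hi, hdivadd j _ hi, ?_⟩
      rw [pos_map, pos_block _ π j hi.le, map_mul]
  · intro i hi j hj hij
    refine Set.disjoint_left.2 ?_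
    rintro h (⟨a, ha, hai, rfl⟩ | ⟨hiJ, hun, hnear⟩) (⟨b, hb, hbj, hab⟩ | ⟨hjJ, hun', hnear'⟩)
    · rw [map_pos, map_pos] at hab
      have := hav.eq ha hb hab
      subst this
      omega
    · exact hun' a ha rfl
    · exact hun b hb hab
    · obtain ⟨h1, h2, h3, h4⟩ := ht i hiJ
      obtain ⟨h1', h2', h3', h4'⟩ := ht j hjJ
      have := hFE _ hnear _ hnear'
      rw [mul_inv_rev, inv_inv, mul_assoc, mul_inv_cancel_left, map_pos, map_pos] at this
      have := h3 _ h1' this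
      omega

lemma flatMap_out_pieces {ι : α → β} {D r : ℕ} {π : List α} {z y : ℕ → List β} {T : Finset ℕ} :
    (pieces D π z y T r).flatMap (Piece.out ι) = (List.range r).flatMap fun j =>
      if j ∈ T then z j ++ y j else (block D π j).map ι := by
  rw [pieces, List.flatMap_map]
  congr 1
  funext j
  split_ifs <;> rfl

/-- A word with isolated detours in many blocks is rewritable. -/
lemma rewritable_of_detours {f : Γ →* H} {φ : β → Γ} {ι : α → β} {K : List β → Prop}
    {F E : Finset H} {C D r : ℕ}
    (hD : 0 < D) (hFE : ∀ g ∈ F, ∀ h ∈ F, g * h⁻¹ ∈ E) (hF1 : 1 ∈ F) {π : List α}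
    (hπ : π.length = D * r) (hav : Avoiding (f ∘ φ ∘ ι) π) {J : Finset ℕ}
    (hJ : J ⊆ Finset.range r) (hJc : r ≤ 4 * J.card)
    (h : ∀ j ∈ J, ∃ t₀ < π.length, t₀ / D = j ∧ Isolated (f ∘ φ ∘ ι) E D π t₀ ∧ ∃ s t z,
      IsDetour f φ ι F C π t₀ s t z ∧
      (s / D = j → t / D = j → ∃ u v, splice ι (block D π j) (s % D) (t % D) z = u ++ v ∧
        ∀ i ≤ j, ¬ K (((List.range' i (j - i)).flatMap (block D π)).map ι ++ u) ∧
          K (((List.range' i (j - i)).flatMap (block D π)).map ι ++ u.dropLast))) :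
    Rewritable ι K (Avoiding φ) D (2 * D + C) r π := by
  classical
  have hFE' : ∀ g ∈ F, g ∈ E := fun g hg => by simpa using hFE g hg 1 hF1
  choose! t₀ ht₀ h₀ hiso s t z hdet huv using h
  have hs : ∀ j ∈ J, s j / D = j := by
    intro j hj
    conv_rhs => rw [← h₀ j hj]
    refine hiso j hj _ (hdet j hj).lt_left (hFE' _ ?_)
    rw [← map_pos, ← map_pos]; exact (hdet j hj).near_left
  have ht : ∀ j ∈ J, t j / D = j := by
    intro j hj
    conv_rhs => rw [← h₀ j hj]
    refine hiso j hj _ (hdet j hj).lt_right (hFE' _ ?_)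
    rw [← map_pos, ← map_pos]; exact (hdet j hj).near_right
  have huv' : ∀ j ∈ J, ∃ u v, splice ι (block D π j) (s j % D) (t j % D) (z j) = u ++ v ∧
        ∀ i ≤ j, ¬ K (((List.range' i (j - i)).flatMap (block D π)).map ι ++ u) ∧
          K (((List.range' i (j - i)).flatMap (block D π)).map ι ++ u.dropLast) :=
    fun j hj => huv j hj (hs j hj) (ht j hj)
  choose! u v huv hK using huv'
  refine ⟨J, hJ, hJc, u, v, ?_, ?_, hK⟩
  · intro j hj
    have h1 : (u j).length + (v j).length ≤ 2 * D + C := by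
      rw [← List.length_append, ← huv j hj]
      have := (hdet j hj).length_le
      have hb := length_block hπ (Finset.mem_range.1 (hJ hj))
      simp only [splice, List.length_append, List.length_map, List.length_take,
        List.length_drop, hb]
      omega
    omega
  · intro T hT
    have := avoiding_of_detours hD hFE hF1 hπ hav
      (fun j hj => ⟨ht₀ j hj, h₀ j hj, hiso j hj, hdet j hj⟩) hT
    rw [flatMap_out_pieces]
    convert this using 3 with j
    split_ifs with hj
    · exact (huv j (hT hj)).symm
    · rfl

end WordWalk

/-! ### Passing to a proper quotient. -/

namespace WordWalk

variable {α β Γ H : Type*} [Group Γ] [Group H]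

/-- Take a shortest nearby word `z` that joins two positions of `π` in `H` but not in `Γ`; `ρ` at
time `t₀` is a candidate. If `z` met `π` in between, one of its two parts would be a shorter
candidate. If `z` repeated a vertex of `H`, the loop would be shorter than `ρ`, hence trivial in
`Γ`, and could be cut out. Reversing `z` if necessary gives `t ≤ s`. -/
lemma exists_detour_of_shortest {f : Γ →* H} {φ : α → Γ} {inv : α → α}
    (hinv : ∀ a, φ (inv a) = (φ a)⁻¹) {ρ : List α} (hρ : f (ρ.map φ).prod = 1)
    (hρ1 : (ρ.map φ).prod ≠ 1)
    (hmin : ∀ z : List α, f (z.map φ).prod = 1 → (z.map φ).prod ≠ 1 → ρ.length ≤ z.length)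
    {F : Finset H} (hF : ∀ i ≤ ρ.length, f (pos φ ρ i) ∈ F) {π : List α} {t₀ : ℕ}
    (ht₀ : t₀ < π.length) :
    ∃ s t z, z ≠ [] ∧ t ≤ s ∧ IsDetour f φ id F ρ.length π t₀ s t z := by
  set x : ℕ → Γ := pos (φ ∘ id) π with hx
  let P : List α → Prop := fun z => ∃ s < π.length, ∃ t < π.length, z ≠ [] ∧
    f (x s * (z.map φ).prod) = f (x t) ∧ x s * (z.map φ).prod ≠ x t ∧
    ∀ i ≤ z.length, (f (x t₀))⁻¹ * f (x s * pos φ z i) ∈ F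
  have hP : P ρ := by
    refine ⟨t₀, ht₀, t₀, ht₀, ?_, by rw [map_mul, hρ, mul_one], by simpa using hρ1, ?_⟩
    · rintro rfl; simp at hρ1
    · intro i hi
      rw [map_mul, inv_mul_cancel_left]
      exact hF i hi
  obtain ⟨z, ⟨s, hs, t, ht, hz, hc, hne, hnear⟩, hzmin⟩ :=
    (measure (List.length (α := α))).wf.has_min {z | P z} ⟨ρ, hP⟩
  have hzmin' : ∀ z', P z' → z.length ≤ z'.length := fun z' h => not_lt.1 (hzmin z' h)
  have hzρ : z.length ≤ ρ.length := hzmin' ρ hP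
  have hun : ∀ i, 0 < i → i < z.length → ∀ t' < π.length, f (x s * pos φ z i) ≠ f (x t') := by
    intro i hi hi' t' ht' e
    -- If the first part closes up in `Γ`, the second part inherits the failure to close up;
    -- otherwise the first part already fails.
    by_cases h : x s * pos φ z i = x t'
    · have hd : ∀ k, x t' * pos φ (z.drop i) k = x s * pos φ z (i + k) := fun k => by
        rw [← h, pos_add, mul_assoc]
      have hv : x t' * ((z.drop i).map φ).prod = x s * (z.map φ).prod := by
        rw [← h, mul_assoc, pos_mul_prod_drop]
      have := hzmin' (z.drop i) ⟨t', ht', t, ht, by simpa using hi', by rw [hv, hc],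
        by rw [hv]; exact hne, fun k hk => by
          rw [hd]
          rw [List.length_drop] at hk
          exact hnear _ (by omega)⟩
      rw [List.length_drop] at this
      omega
    · have := hzmin' (z.take i) ⟨s, hs, t', ht',
        List.length_pos_iff.1 (by rw [List.length_take]; omega), e, h, fun k hk => by
        simp only [List.length_take, le_min_iff] at hk
        rw [pos_take _ _ hk.1]
        exact hnear _ hk.2⟩
      simp only [List.length_take] at this
      omega
  have hzav : Avoiding (f ∘ φ) z := by
    intro i j hij hj e
    obtain ⟨d, rfl⟩ := Nat.exists_eq_add_of_le hij.le
    have h1 : pos φ (z.drop i) d = 1 := by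
      by_contra h
      have := hmin ((z.drop i).take d) (by
        rw [prod_take, map_pos]
        rw [pos_add] at e
        exact left_eq_mul.1 e) (by rwa [prod_take])
      simp only [List.length_take, List.length_drop] at this
      omega
    have hd : ∀ k, pos φ z (i + d + k) = pos φ z i * pos φ (z.drop (i + d)) k := fun k => by
      rw [pos_add, pos_add, h1, mul_one]
    have hl : (z.take i).length = i := by simp; omega
    have hv : ((z.take i ++ z.drop (i + d)).map φ).prod = (z.map φ).prod := by
      rw [List.map_append, List.prod_append, prod_take, ← pos_mul_prod_drop φ z (i + d), pos_add,
        h1, mul_one]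
    have := hzmin' (z.take i ++ z.drop (i + d)) ⟨s, hs, t, ht, by simp; omega, by rw [hv, hc],
      by rw [hv]; exact hne, fun k hk => by
        rw [List.length_append, hl, List.length_drop] at hk
        rcases le_or_gt k i with h | h
        · rw [pos_append_of_le _ _ (by omega), pos_take _ _ h]
          exact hnear _ (by omega)
        · obtain ⟨m, rfl⟩ := Nat.exists_eq_add_of_lt h
          have e2 := pos_append_add φ (z.take i) (z.drop (i + d)) (m + 1)
          rw [hl, prod_take, ← hd, ← add_assoc] at e2
          rw [e2]
          exact hnear _ (by omega)⟩
    rw [List.length_append, hl, List.length_drop] at this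
    omega
  have hear : IsEar f φ id F ρ.length π t₀ s t z := by
    refine ⟨hs, ht, hzρ, hc, hzav, hun, fun i _ hi => hnear i hi.le, ?_, ?_⟩
    · have := hnear 0 (Nat.zero_le _)
      rwa [pos_zero, mul_one] at this
    · rw [← hx, ← hc, ← pos_length]
      exact hnear _ le_rfl
  rcases le_total t s with h | h
  · exact ⟨s, t, z, hz, h, hear, fun _ => hne⟩
  · refine ⟨t, s, invWord inv z, by simpa [invWord] using hz, h, hear.reverse hinv, fun _ e => ?_⟩
    rw [prod_map_invWord hinv, mul_inv_eq_iff_eq_mul] at e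
    exact hne e.symm

lemma flatMap_block_eq (D : ℕ) (π : List α) (i m : ℕ) :
    (List.range' i m).flatMap (block D π) = (π.drop (D * i)).take (D * m) := by
  induction m with
  | zero => simp
  | succ m ih =>
    rw [List.range'_concat, List.flatMap_append, ih, List.flatMap_singleton, mul_add, mul_one,
      List.take_add, List.drop_drop, block]
    congr 4
    ring

/-- Since `t ≤ s`, the end of `z` is, in `H`, the vertex already visited at time `t`, and this is
the first repetition in `H`. The kept blocks read before are part of the self-avoiding walk and do
not disturb this. -/
lemma mark_of_detour {f : Γ →* H} {φ : α → Γ} {F : Finset H} {C D r : ℕ} {π : List α}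
    (hD : 0 < D) (hπ : π.length = D * r) (hav : Avoiding (f ∘ φ ∘ id) π) {t₀ s t j : ℕ}
    {z : List α} (hz : z ≠ []) (hts : t ≤ s) (h : IsEar f φ id F C π t₀ s t z) (hs : s / D = j)
    (ht : t / D = j) :
    ∃ u v, splice id (block D π j) (s % D) (t % D) z = u ++ v ∧
      ∀ i ≤ j, ¬ Avoiding (f ∘ φ) (((List.range' i (j - i)).flatMap (block D π)).map id ++ u) ∧
        Avoiding (f ∘ φ) (((List.range' i (j - i)).flatMap (block D π)).map id ++ u.dropLast) := by
  have hj : j < r := by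
    rw [← hs]; exact Nat.div_lt_of_lt_mul (by rw [← hπ]; exact h.lt_left)
  have hb : (block D π j).length = D := length_block hπ hj
  have htD : t % D < (block D π j).length := by rw [hb]; exact Nat.mod_lt _ hD
  -- `Avoiding` ignores the final position, so one more letter is needed for the end of `z` to count
  -- as a repetition.
  refine ⟨(block D π j).take (s % D) ++ z ++ [(block D π j)[t % D]],
    (block D π j).drop (t % D + 1), ?_, fun i hi => ?_⟩
  · simp only [splice, List.map_id, List.append_assoc, List.singleton_append]
    rw [← List.drop_eq_getElem_cons htD]
  · have hsD := Nat.div_add_mod s D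
    rw [hs] at hsD
    have htD' := Nat.div_add_mod t D
    rw [ht] at htD'
    have hij : D * i ≤ D * j := Nat.mul_le_mul_left _ hi
    set q := (π.drop (D * i)).take (s - D * i) with hq
    have hqe : ((List.range' i (j - i)).flatMap (block D π)).map id ++
        (block D π j).take (s % D) = q := by
      rw [List.map_id, flatMap_block_eq, block, List.take_take,
        min_eq_left (Nat.mod_lt _ hD).le, hq]
      have e1 : s - D * i = D * (j - i) + s % D := by rw [Nat.mul_sub]; omega
      rw [e1, List.take_add, List.drop_drop]
      congr 4
      rw [Nat.mul_sub]; omega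
    have hql : q.length = s - D * i := by
      have := h.lt_left
      simp [hq]; omega
    have hqpos : ∀ k ≤ s - D * i, pos φ π (D * i) * pos φ q k = pos φ π (D * i + k) := by
      intro k hk
      rw [hq, pos_take _ _ hk, ← pos_add]
    have hqprod : pos φ π (D * i) * (q.map φ).prod = pos φ π s := by
      rw [← pos_length, hql, hqpos _ le_rfl]
      congr 1; omega
    rw [List.dropLast_concat, ← List.append_assoc, ← List.append_assoc, hqe]
    have hqf : ∀ k, pos (f ∘ φ) q k = f (pos φ q k) := fun k => (map_pos f φ q k).symm
    have hcl : f (pos φ π s * (z.map φ).prod) = f (pos φ π t) := h.close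
    constructor
    · intro hA
      refine hA (t - D * i) ((q ++ z).length) ?_ (by simp) ?_
      · have := List.length_pos_iff.2 hz
        rw [List.length_append, hql]; omega
      · rw [pos_append_of_le _ _ (by rw [List.length_append, hql]; omega),
          pos_append_of_le _ _ (by omega), pos_append_of_le _ _ le_rfl, pos_length, hqf,
          ← map_prod]
        refine mul_left_cancel (a := f (pos φ π (D * i))) ?_
        rw [← map_mul, ← map_mul, hqpos _ (by omega), List.map_append, List.prod_append,
          ← mul_assoc, hqprod, hcl]
        congr 2; omega
    · have hav' : Avoiding (f ∘ φ) π := hav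
      refine avoiding_append.2 ⟨(hav'.drop _).take _, h.avoiding, fun k k' hk hk' e => ?_⟩
      rw [hql] at hk
      rw [hqf, ← map_prod, ← map_pos, ← map_mul] at e
      have e' := congrArg (f (pos φ π (D * i)) * ·) e
      simp only [← map_mul] at e'
      rw [hqpos _ (by omega), ← mul_assoc, hqprod] at e'
      rcases Nat.eq_zero_or_pos k' with rfl | hk0
      · rw [pos_zero, mul_one, map_pos, map_pos] at e'
        have h1 := h.lt_left
        have := hav'.eq (by omega) h1 e'
        omega
      · exact h.unvisited k' hk0 hk' (D * i + k) (by have := h.lt_left; omega) e'.symm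

lemma wordsWith_avoiding [Finite α] (φ : α → Γ) (n : ℕ) :
    wordsWith (Avoiding φ) n = words φ n := by
  ext w; rw [mem_wordsWith, mem_words]

/-- The number of self-avoiding words grows strictly faster in a group than in a proper quotient of
the group. -/
theorem not_growthLE_of_quotient [Finite α] {φ : α → Γ} {inv : α → α}
    (hinv : ∀ a, φ (inv a) = (φ a)⁻¹) {f : Γ →* H}
    (hker : ∃ w : List α, f (w.map φ).prod = 1 ∧ (w.map φ).prod ≠ 1) {l : ℝ} (hl : 1 ≤ l)
    (hlb : ∀ n, l ^ n ≤ ((words (f ∘ φ) n).card : ℝ))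
    (hub : GrowthLE (fun n => (words (f ∘ φ) n).card) l) :
    ¬ GrowthLE (fun n => (words φ n).card) l := by
  classical
  obtain ⟨ρ, ⟨hρ, hρ1⟩, hmin⟩ := (measure (List.length (α := α))).wf.has_min
    {w | f (w.map φ).prod = 1 ∧ (w.map φ).prod ≠ 1} hker
  have hmin' : ∀ z : List α, f (z.map φ).prod = 1 → (z.map φ).prod ≠ 1 →
      ρ.length ≤ z.length := fun z h1 h2 => not_lt.1 (hmin z ⟨h1, h2⟩)
  set F : Finset H := (Finset.range (ρ.length + 1)).image fun i => f (pos φ ρ i) with hF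
  have hFm : ∀ i ≤ ρ.length, f (pos φ ρ i) ∈ F := fun i hi =>
    Finset.mem_image_of_mem _ (Finset.mem_range.2 (by omega))
  have hF1 : 1 ∈ F := by simpa using hFm 0 (by omega)
  -- Isolation with respect to `F * F⁻¹` keeps the `F`-neighbourhoods of isolated times in different
  -- blocks disjoint.
  set E : Finset H := (F ×ˢ F).image fun p => p.1 * p.2⁻¹ with hE
  have hFE : ∀ g ∈ F, ∀ h ∈ F, g * h⁻¹ ∈ E := fun g hg h hh =>
    Finset.mem_image.2 ⟨(g, h), Finset.mem_product.2 ⟨hg, hh⟩, rfl⟩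
  obtain ⟨D, hD, hfreq⟩ := exists_scale (by linarith) hlb hub E
  have := not_growthLE_of_rewritable (ι := id) (K := Avoiding (f ∘ φ)) (A := Avoiding φ)
    Function.injective_id (fun u v huv hv => hv.of_prefix huv) hl (C := 2 * D + ρ.length) hD
    (fun x hx hxl => (hfreq x hx hxl).mono fun r hr =>
      ⟨goodWords (f ∘ φ) E D r, hr, fun π hπ => ?_⟩)
  · simpa only [wordsWith_avoiding] using this
  · obtain ⟨hw, hgood⟩ := Finset.mem_filter.1 hπ
    obtain ⟨hlen, hav⟩ := mem_words.1 hw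
    refine ⟨hlen, rewritable_of_detours (F := F) (E := E) (C := ρ.length) hD hFE hF1 hlen hav
      (J := goodBlocks (f ∘ φ) E D r π) (Finset.filter_subset _ _) (by omega) fun j hj => ?_⟩
    obtain ⟨-, t₀, ht₀, h0, hiso⟩ := Finset.mem_filter.1 hj
    obtain ⟨s, t, z, hz, hts, hd⟩ := exists_detour_of_shortest hinv hρ hρ1 hmin' hFm ht₀
    exact ⟨t₀, ht₀, h0, hiso, s, t, z, hd, mark_of_detour hD hlen hav hz hts hd.toIsEar⟩

end WordWalk

/-! ### Connection in the complement of 1, and insertion of a new letter. -/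

namespace WordWalk

variable {α β Γ H : Type*} [Group Γ] [Group H]

/-- Some word leads from `x` to `y` and avoids `1`. -/
def Linked (χ : α → Γ) (x y : Γ) : Prop :=
  ∃ u : List α, x * (u.map χ).prod = y ∧ ∀ i ≤ u.length, x * pos χ u i ≠ 1

lemma Linked.refl (χ : α → Γ) {x : Γ} (hx : x ≠ 1) : Linked χ x x :=
  ⟨[], by simp, by simpa using hx⟩

lemma Linked.trans {χ : α → Γ} {x y z : Γ} (h : Linked χ x y) (h' : Linked χ y z) :
    Linked χ x z := by
  obtain ⟨u, rfl, hu⟩ := h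
  obtain ⟨v, rfl, hv⟩ := h'
  refine ⟨u ++ v, by simp [mul_assoc], fun i hi => ?_⟩
  rcases le_total i u.length with h | h
  · rw [pos_append_of_le _ _ h]; exact hu i h
  · obtain ⟨k, rfl⟩ := Nat.exists_eq_add_of_le h
    rw [pos_append_add, ← mul_assoc]
    rw [List.length_append] at hi
    exact hv k (by omega)

lemma Linked.ne_one_right {χ : α → Γ} {x y : Γ} (h : Linked χ x y) : y ≠ 1 := by
  obtain ⟨u, rfl, hu⟩ := h
  rw [← pos_length]
  exact hu _ le_rfl

lemma Linked.symm {χ : α → Γ} {inv : α → α} (hinv : ∀ a, χ (inv a) = (χ a)⁻¹) {x y : Γ}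
    (h : Linked χ x y) : Linked χ y x := by
  obtain ⟨u, rfl, hu⟩ := h
  refine ⟨invWord inv u, by rw [prod_map_invWord hinv]; simp, fun i hi => ?_⟩
  rw [mul_assoc, prod_mul_pos_invWord hinv]
  exact hu _ (by omega)

/-- A word between linked elements may be chosen to be self-avoiding. -/
lemma Linked.exists_avoiding {χ : α → Γ} {x y : Γ} (h : Linked χ x y) :
    ∃ u : List α, x * (u.map χ).prod = y ∧ (∀ i ≤ u.length, x * pos χ u i ≠ 1) ∧
      Avoiding χ u := by
  obtain ⟨u, ⟨hu, hu1⟩, hmin⟩ := (measure (List.length (α := α))).wf.has_min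
    {u | x * (u.map χ).prod = y ∧ ∀ i ≤ u.length, x * pos χ u i ≠ 1} h
  refine ⟨u, hu, hu1, fun i j hij hj e => hmin (u.take i ++ u.drop j) ⟨?_, fun k hk => ?_⟩ ?_⟩
  · rw [List.map_append, List.prod_append, prod_take, e, pos_mul_prod_drop, hu]
  · have hl : (u.take i).length = i := by simp; omega
    rw [List.length_append, hl, List.length_drop] at hk
    rcases le_total k i with h | h
    · rw [pos_append_of_le _ _ (by omega), pos_take _ _ h]
      exact hu1 _ (by omega)
    · obtain ⟨m, rfl⟩ := Nat.exists_eq_add_of_le h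
      have e2 := pos_append_add χ (u.take i) (u.drop j) m
      rw [hl, prod_take, e, ← pos_add] at e2
      rw [e2]
      exact hu1 _ (by omega)
  · change (u.take i ++ u.drop j).length < u.length
    rw [List.length_append, List.length_take, List.length_drop]
    omega

/-- Translating by `y` an element that is not linked to `y⁻¹` gives an element linked to `y`. -/
lemma linked_mul {χ : α → Γ} {inv : α → α} (hinv : ∀ a, χ (inv a) = (χ a)⁻¹)
    (hgen : ∀ g : Γ, ∃ u : List α, (u.map χ).prod = g) {x y : Γ} (hy : y ≠ 1)
    (h : ¬ Linked χ x y⁻¹) : Linked χ y (y * x) := by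
  -- If the translate by `y` of a shortest word to `x` hits 1, the word passes through `y⁻¹`. By
  -- minimality the rest of it avoids 1, so it links `y⁻¹` to `x`.
  obtain ⟨u, hu, hmin⟩ := (measure (List.length (α := α))).wf.has_min
    {u | (u.map χ).prod = x} (hgen x)
  refine ⟨u, by rw [hu], fun i hi e => ?_⟩
  have hi0 : i ≠ 0 := by
    rintro rfl
    exact hy (by simpa using e)
  have e' : pos χ u i = y⁻¹ := (eq_inv_of_mul_eq_one_right e)
  refine h (Linked.symm hinv ⟨u.drop i, by rw [← e', pos_mul_prod_drop, hu], fun k hk e2 => ?_⟩)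
  rw [← e', ← pos_add] at e2
  rw [List.length_drop] at hk
  refine hmin (u.drop (i + k)) ?_ ?_
  · change ((u.drop (i + k)).map χ).prod = x
    rw [← hu, ← pos_mul_prod_drop χ u (i + k), e2, one_mul]
  · change (u.drop (i + k)).length < u.length
    rw [List.length_drop]; omega

lemma ne_of_avoiding_append {χ : α → Γ} {u v : List α} (h : Avoiding χ (u ++ v)) (hv : v ≠ [])
    {i j : ℕ} (hij : i < j) (hj : j ≤ u.length) : pos χ u i ≠ pos χ u j := by
  have hl := List.length_pos_iff.2 hv
  have := h i j hij (by rw [List.length_append]; omega)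
  rwa [pos_append_of_le _ _ (by omega), pos_append_of_le _ _ hj] at this

/-- The end of a self-avoiding walk is linked to its first step. -/
lemma linked_pos_one {χ : α → Γ} {u v : List α} (h : Avoiding χ (u ++ v)) (hv : v ≠ [])
    (hu : u ≠ []) : Linked χ (pos χ u 1) (u.map χ).prod := by
  have hl := List.length_pos_iff.2 hu
  refine ⟨u.drop 1, pos_mul_prod_drop _ _ _, fun i hi e => ?_⟩
  rw [← pos_add] at e
  rw [List.length_drop] at hi
  exact ne_of_avoiding_append h hv (i := 0) (j := 1 + i) (by omega) (by omega)
    (by rw [e, pos_zero])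

/-- Seen from its end, the start of a self-avoiding walk is linked to its last step. -/
lemma linked_inv_last {χ : α → Γ} {u v : List α} {e : α} (h : Avoiding χ (u ++ [e] ++ v))
    (hv : v ≠ []) : Linked χ (((u ++ [e]).map χ).prod)⁻¹ (χ e)⁻¹ := by
  refine ⟨u, by simp, fun i hi e2 => ?_⟩
  refine ne_of_avoiding_append h hv (i := i) (j := (u ++ [e]).length) (by simp; omega) le_rfl ?_
  rw [pos_append_of_le _ _ hi, pos_length, eq_comm, ← inv_mul_eq_one]
  exact e2

section insertion

/-- Insert the letter `ω` before every letter that carries the flag `true`. -/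
def insertFlagged (ι : α → β) (ω : β) (W : List (α × Bool)) : List β :=
  W.flatMap fun p => if p.2 then [ω, ι p.1] else [ι p.1]

/-- At every flagged letter of `W`, the step `w` is not linked to the way back along the previous
letter (which is `e` for the first letter of `W`), nor the step `w⁻¹` to the flagged letter. -/
def Insertable (χ : α → Γ) (w : Γ) : α → List (α × Bool) → Prop
  | _, [] => True
  | e, (a, b) :: W => (b = true → ¬ Linked χ w (χ e)⁻¹ ∧ (W ≠ [] → ¬ Linked χ w⁻¹ (χ a))) ∧
      Insertable χ w a W

variable {φ : β → Γ} {ι : α → β} {inv : α → α} {ω : β}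

/-- The invariant behind the insertions: after its first step the modified walk stays in one
component of the complement of 1, so it never returns to 1. Seen from the current vertex, the
inserted step enters a component that does not contain the start of the walk, and what follows is
carried along by `linked_mul`. -/
lemma linked_insertFlagged (hinv : ∀ a, φ (ι (inv a)) = (φ (ι a))⁻¹)
    (hgen : ∀ g : Γ, ∃ u : List α, (u.map (φ ∘ ι)).prod = g) (hω : φ ω ≠ 1)
    (W : List (α × Bool)) (u : List α) (e : α) (hW : Insertable (φ ∘ ι) (φ ω) e W)
    (hav : Avoiding (φ ∘ ι) (u ++ [e] ++ W.map Prod.fst)) :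
    ∀ i < (insertFlagged ι ω W).length, Linked (φ ∘ ι) (pos (φ ∘ ι) (u ++ [e]) 1)
      (((u ++ [e]).map (φ ∘ ι)).prod * pos φ (insertFlagged ι ω W) i) := by
  induction W generalizing u e with
  | nil => intro i hi; simp [insertFlagged] at hi
  | cons p W ih =>
    obtain ⟨a, b⟩ := p
    obtain ⟨hb, hW⟩ := hW
    have hne : ((a, b) :: W).map Prod.fst ≠ [] := by simp
    have h0 := linked_pos_one hav hne (by simp)
    have hle : 1 ≤ (u ++ [e]).length := by simp
    have hinv' : ∀ a, (φ ∘ ι) (inv a) = ((φ ∘ ι) a)⁻¹ := hinv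
    intro i hi
    cases b with
    | false =>
      have e1 : insertFlagged ι ω ((a, false) :: W) = ι a :: insertFlagged ι ω W := rfl
      rw [e1] at hi ⊢
      rcases i with _ | i
      · simpa using h0
      · have := ih (u ++ [e]) a hW (by simpa using hav) i (by simpa using hi)
        rw [pos_append_of_le _ _ hle, List.map_append, List.prod_append] at this
        rw [pos_cons_succ]
        simpa [mul_assoc] using this
    | true =>
      have hb := hb rfl
      have e1 : insertFlagged ι ω ((a, true) :: W) = ω :: ι a :: insertFlagged ι ω W := rfl
      rw [e1] at hi ⊢
      -- An element linked to `φ ω` cannot be linked to the start as seen from here: the start is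
      -- linked to the way back along `e`.
      have hB : ∀ v, Linked (φ ∘ ι) (φ ω) v → Linked (φ ∘ ι) (pos (φ ∘ ι) (u ++ [e]) 1)
          (((u ++ [e]).map (φ ∘ ι)).prod * v) := by
        intro v hv
        refine h0.trans (linked_mul hinv' hgen h0.ne_one_right fun h => hb.1 ?_)
        exact hv.trans (h.trans (linked_inv_last hav hne))
      rcases i with _ | _ | i
      · simpa using h0
      · simpa [pos_cons_succ] using hB _ (Linked.refl _ hω)
      · have hi' : i < (insertFlagged ι ω W).length := by simpa using hi
        -- The position after the last letter is not counted, so the condition on the flagged letter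
        -- is needed only if further letters follow.
        have hWne : W ≠ [] := by rintro rfl; simp [insertFlagged] at hi'
        have hsuf : Avoiding (φ ∘ ι) ([a] ++ W.map Prod.fst) := by
          have := (avoiding_append.1 hav).2.1
          simpa using this
        have h1 := ih [] a hW (by simpa using hsuf) i hi'
        simp only [List.nil_append] at h1
        rw [pos_cons_succ, pos_cons_succ]
        refine hB _ (linked_mul hinv' hgen hω fun h => hb.2 hWne ?_)
        refine (Linked.symm hinv' ?_)
        refine Linked.trans ?_ h
        simpa [pos] using h1

lemma avoiding_insertFlagged (hinv : ∀ a, φ (ι (inv a)) = (φ (ι a))⁻¹)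
    (hgen : ∀ g : Γ, ∃ u : List α, (u.map (φ ∘ ι)).prod = g) (hω : φ ω ≠ 1)
    (W : List (α × Bool)) (hav : Avoiding (φ ∘ ι) (W.map Prod.fst))
    (hW : ∀ a b W', W = (a, b) :: W' →
      (b = true → W' ≠ [] → ¬ Linked (φ ∘ ι) (φ ω)⁻¹ (φ (ι a))) ∧
        Insertable (φ ∘ ι) (φ ω) a W') :
    Avoiding φ (insertFlagged ι ω W) := by
  induction W with
  | nil => exact avoiding_nil φ
  | cons p W ih =>
    obtain ⟨a, b⟩ := p
    obtain ⟨hb, hI⟩ := hW a b W rfl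
    have hsuf : Avoiding (φ ∘ ι) (W.map Prod.fst) := hav.drop 1
    have hih := ih hsuf (by
      rintro a' b' W' rfl
      exact ⟨fun h h' => (hI.1 h).2 h', hI.2⟩)
    have hinv' : ∀ a, (φ ∘ ι) (inv a) = ((φ ∘ ι) a)⁻¹ := hinv
    have hlink := linked_insertFlagged hinv hgen hω W [] a hI (by simpa using hav)
    have hlink' : ∀ i < (insertFlagged ι ω W).length,
        Linked (φ ∘ ι) (φ (ι a)) (φ (ι a) * pos φ (insertFlagged ι ω W) i) := by
      intro i hi
      simpa [pos] using hlink i hi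
    have h1 : Avoiding φ (ι a :: insertFlagged ι ω W) :=
      avoiding_cons.2 ⟨hih, fun j hj => (hlink' j hj).ne_one_right⟩
    cases b with
    | false => exact h1
    | true =>
      change Avoiding φ (ω :: ι a :: insertFlagged ι ω W)
      refine avoiding_cons.2 ⟨h1, fun j hj => ?_⟩
      rcases j with _ | j
      · simpa using hω
      · have hj' : j < (insertFlagged ι ω W).length := by simpa using hj
        have hWne : W ≠ [] := by rintro rfl; simp [insertFlagged] at hj'
        rw [pos_cons_succ]
        refine (linked_mul hinv' hgen hω fun h => hb rfl hWne ?_).ne_one_right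
        exact Linked.symm hinv' ((hlink' j hj').trans h)

/-- Flag the letters of a word by a predicate on their indices, which start from `k`. -/
def annotate (P : ℕ → Bool) : ℕ → List α → List (α × Bool)
  | _, [] => []
  | k, a :: l => (a, P k) :: annotate P (k + 1) l

lemma annotate_append (P : ℕ → Bool) (k : ℕ) (u v : List α) :
    annotate P k (u ++ v) = annotate P k u ++ annotate P (k + u.length) v := by
  induction u generalizing k with
  | nil => rfl
  | cons a u ih =>
    rw [List.cons_append, annotate, ih, annotate, List.length_cons, List.cons_append]
    congr 3
    omega

lemma map_fst_annotate (P : ℕ → Bool) (k : ℕ) (u : List α) :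
    (annotate P k u).map Prod.fst = u := by
  induction u generalizing k with
  | nil => rfl
  | cons a u ih => rw [annotate, List.map_cons, ih]

lemma length_annotate (P : ℕ → Bool) (k : ℕ) (u : List α) : (annotate P k u).length = u.length := by
  conv_rhs => rw [← map_fst_annotate P k u]
  rw [List.length_map]

lemma insertFlagged_append (ι : α → β) (ω : β) (U V : List (α × Bool)) :
    insertFlagged ι ω (U ++ V) = insertFlagged ι ω U ++ insertFlagged ι ω V :=
  List.flatMap_append

lemma insertFlagged_annotate_of_false {P : ℕ → Bool} {k : ℕ} {u : List α}
    (h : ∀ i < u.length, P (k + i) = false) :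
    insertFlagged ι ω (annotate P k u) = u.map ι := by
  induction u generalizing k with
  | nil => rfl
  | cons a u ih =>
    have h0 : P k = false := h 0 (by simp)
    have h1 := ih (k := k + 1) fun i hi => by
      have := h (i + 1) (by simpa using hi)
      rwa [show k + 1 + i = k + (i + 1) by omega]
    rw [annotate, h0]
    change ι a :: insertFlagged ι ω (annotate P (k + 1) u) = _
    rw [h1, List.map_cons]

lemma insertFlagged_annotate_of_unique {P : ℕ → Bool} {k s : ℕ} {u : List α} (hs : s < u.length)
    (h : ∀ i < u.length, P (k + i) = true ↔ i = s) :
    insertFlagged ι ω (annotate P k u) = splice ι u s s [ω] := by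
  have hl : (u.take s).length = s := by simp; omega
  have e : u = u.take s ++ ([u[s]] ++ u.drop (s + 1)) := by
    rw [List.singleton_append, ← List.drop_eq_getElem_cons hs, List.take_append_drop]
  have hfalse : ∀ i < u.length, i ≠ s → P (k + i) = false := fun i hi hne => by
    rw [← Bool.not_eq_true, h i hi]; exact hne
  conv_lhs => rw [e]
  rw [annotate_append, annotate_append, insertFlagged_append, insertFlagged_append,
    insertFlagged_annotate_of_false (u := u.take s) (fun i hi => hfalse i (by omega) (by omega)),
    insertFlagged_annotate_of_false (u := u.drop (s + 1)), splice,
    List.drop_eq_getElem_cons hs, hl]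
  · have hP : P (k + s) = true := (h s hs).2 rfl
    simp only [annotate, hP]
    have hd : (u.map ι).drop s = ι u[s] :: (u.map ι).drop (s + 1) := by
      rw [List.drop_eq_getElem_cons (by simpa using hs), List.getElem_map]
    simp [insertFlagged, hd]
  · intro i hi
    rw [List.length_drop] at hi
    rw [hl, List.length_singleton, show k + s + 1 + i = k + (s + 1 + i) by omega]
    exact hfalse _ (by omega) (by omega)

lemma insertable_annotate {χ : α → Γ} {w : Γ} {P : ℕ → Bool} {k : ℕ} {e : α} {l : List α}
    (h : ∀ i e' a, P (k + i) = true → (e :: l)[i]? = some e' → l[i]? = some a →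
      ¬ Linked χ w (χ e')⁻¹ ∧ (i + 1 < l.length → ¬ Linked χ w⁻¹ (χ a))) :
    Insertable χ w e (annotate P k l) := by
  induction l generalizing k e with
  | nil => trivial
  | cons a l ih =>
    refine ⟨fun hP => ?_, ih fun i e' a' hP he' ha' => ?_⟩
    · have := h 0 e a hP rfl rfl
      refine ⟨this.1, fun hl => this.2 ?_⟩
      have := List.length_pos_iff.2 hl
      rw [length_annotate] at this
      simpa using this
    · have := h (i + 1) e' a' (by rwa [show k + (i + 1) = k + 1 + i by omega]) (by simpa using he')
        (by simpa using ha')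
      exact ⟨this.1, fun hi => this.2 (by simpa using hi)⟩

lemma insertFlagged_annotate_flatMap (P : ℕ → Bool) {D r : ℕ} {π : List α}
    (hπ : π.length = D * r) :
    insertFlagged ι ω (annotate P 0 π) = (List.range r).flatMap fun j =>
      insertFlagged ι ω (annotate P (D * j) (block D π j)) := by
  suffices h : ∀ k ≤ r, insertFlagged ι ω (annotate P 0 (π.take (D * k))) =
      (List.range k).flatMap fun j => insertFlagged ι ω (annotate P (D * j) (block D π j)) by
    have := h r le_rfl
    rwa [← hπ, List.take_length] at this
  intro k
  induction k with
  | zero => intro _; simp [annotate, insertFlagged]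
  | succ k ih =>
    intro hk
    have : D * k ≤ D * r := Nat.mul_le_mul_left _ (by omega)
    rw [mul_add, mul_one, List.take_add, annotate_append, insertFlagged_append, ih (by omega),
      List.range_succ, List.flatMap_append, List.flatMap_singleton, List.length_take,
      min_eq_left (by omega), zero_add, block]

end insertion

end WordWalk

/-! ### Ears and insertions that use a new letter. -/

namespace WordWalk

variable {α β Γ H : Type*} [Group Γ] [Group H]

/-- All letters come from the smaller alphabet. -/
def Plain (ι : α → β) (u : List β) : Prop := ∀ b ∈ u, b ∈ Set.range ι

/-- The cut is made just after the first new letter; kept blocks contain only old letters, so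
whatever is read before does not move it. -/
lemma exists_first_not_plain {ι : α → β} {L : List β} (h : ¬ Plain ι L) :
    ∃ u v, L = u ++ v ∧ ∀ p : List α,
      ¬ Plain ι (p.map ι ++ u) ∧ Plain ι (p.map ι ++ u.dropLast) := by
  induction L with
  | nil => exact (h (by simp [Plain])).elim
  | cons b L ih =>
    by_cases hb : b ∈ Set.range ι
    · obtain ⟨u, v, rfl, huv⟩ := ih fun hL => h fun c hc =>
        (List.mem_cons.1 hc).elim (fun e => e ▸ hb) (hL c)
      have hu : u ≠ [] := by
        rintro rfl
        exact (huv []).1 (by simp [Plain])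
      refine ⟨b :: u, v, rfl, fun p => ⟨fun hp => (huv []).1 fun c hc => hp c ?_, ?_⟩⟩
      · simp at hc; simp [hc]
      · rw [List.dropLast_cons_of_ne_nil hu]
        intro c hc
        rcases List.mem_append.1 hc with hc | hc
        · obtain ⟨a, -, rfl⟩ := List.mem_map.1 hc
          exact ⟨a, rfl⟩
        · rcases List.mem_cons.1 hc with rfl | hc
          · exact hb
          · exact (huv []).2 c (by simpa using hc)
    · refine ⟨[b], L, rfl, fun p => ⟨fun hp => hb (hp b (by simp)), fun c hc => ?_⟩⟩
      rw [List.dropLast_singleton, List.append_nil] at hc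
      obtain ⟨a, -, rfl⟩ := List.mem_map.1 hc
      exact ⟨a, rfl⟩

lemma not_plain_splice {ι : α → β} {b : List α} {s t : ℕ} {z : List β} {ω : β} (hω : ω ∈ z)
    (hωι : ω ∉ Set.range ι) : ¬ Plain ι (splice ι b s t z) :=
  fun h => hωι (h ω (by simp [splice, hω]))

/-- If a step along a new letter `ω` is linked to a neighbour `g` on the walk, then the walk has an
ear that begins with `ω`. -/
lemma exists_ear {φ : β → Γ} {ι : α → β} {F : Finset Γ} {C : ℕ} {π : List α} {t₀ t₁ : ℕ} {ω : β}
    {g : Γ} {u : List α} (ht₀ : t₀ < π.length) (ht₁ : t₁ < π.length)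
    (hg : pos (φ ∘ ι) π t₀ * g = pos (φ ∘ ι) π t₁)
    (hu : φ ω * (u.map (φ ∘ ι)).prod = g) (hu1 : ∀ i ≤ u.length, φ ω * pos (φ ∘ ι) u i ≠ 1)
    (hav : Avoiding (φ ∘ ι) u) (hF1 : 1 ∈ F) (hF : ∀ i ≤ u.length, φ ω * pos (φ ∘ ι) u i ∈ F)
    (hC : u.length < C) :
    ∃ t z, t ≠ t₀ ∧ ω ∈ z ∧ IsEar (MonoidHom.id Γ) φ ι F C π t₀ t₀ t z := by
  classical
  set x : ℕ → Γ := pos (φ ∘ ι) π with hx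
  -- The path is stopped at its first return to `π`, which makes its interior unvisited. The return
  -- is not at time `t₀` because `u` avoids that vertex.
  have hex : ∃ i, i ≤ u.length ∧ ∃ t < π.length, x t₀ * (φ ω * pos (φ ∘ ι) u i) = x t :=
    ⟨u.length, le_rfl, t₁, ht₁, by rw [pos_length, hu, hg]⟩
  obtain ⟨hi, t, ht, hit⟩ := Nat.find_spec hex
  have hmin := fun k (hk : k < Nat.find hex) => Nat.find_min hex hk
  set i := Nat.find hex with hidef
  have hpz : ∀ k ≤ i, pos φ (ω :: (u.take i).map ι) (k + 1) = φ ω * pos (φ ∘ ι) u k := by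
    intro k hk
    rw [pos_cons_succ, pos_map, pos_take _ _ hk]
  have hlen : (ω :: (u.take i).map ι).length = i + 1 := by simp; omega
  refine ⟨t, ω :: (u.take i).map ι, ?_, by simp, ht₀, ht, by omega, ?_, ?_, ?_, ?_, ?_, ?_⟩
  · rintro rfl
    exact hu1 i hi (mul_eq_left.1 hit)
  · simp only [MonoidHom.id_apply]
    rw [← pos_length, hlen, hpz _ le_rfl]
    exact hit
  · refine avoiding_cons.2 ⟨avoiding_map.2 (hav.take i), fun j hj => ?_⟩
    have hj' : j < i := by
      rw [List.length_cons] at hlen; omega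
    change φ ω * pos φ ((u.take i).map ι) j ≠ 1
    rw [pos_map, pos_take _ _ hj'.le]
    exact hu1 j (by omega)
  · intro k hk0 hk t' ht' e
    obtain ⟨k, rfl⟩ := Nat.exists_eq_add_of_lt hk0
    rw [zero_add] at *
    rw [hlen] at hk
    simp only [MonoidHom.id_apply] at e
    rw [hpz _ (by omega)] at e
    exact hmin k (by omega) ⟨by omega, t', ht', e⟩
  · intro k hk0 hk
    obtain ⟨k, rfl⟩ := Nat.exists_eq_add_of_lt hk0
    rw [zero_add] at *
    rw [hlen] at hk
    simp only [MonoidHom.id_apply]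
    rw [hpz _ (by omega), inv_mul_cancel_left]
    exact hF _ (by omega)
  · simpa using hF1
  · simp only [MonoidHom.id_apply]
    rw [← hx, ← hit, inv_mul_cancel_left]
    exact hF _ hi

/-- An ear may be used as a detour in one of its two directions. -/
lemma IsEar.exists_detour {φ : β → Γ} {ι : α → β} {F : Finset Γ} {C : ℕ} {π : List α}
    {t₀ t : ℕ} {z : List β} (h : IsEar (MonoidHom.id Γ) φ ι F C π t₀ t₀ t z) (hne : t ≠ t₀)
    {inv : β → β} (hinv : ∀ b, φ (inv b) = (φ b)⁻¹)
    (hι : ∀ b, inv b ∈ Set.range ι → b ∈ Set.range ι) {ω : β} (hω : ω ∈ z)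
    (hωι : ω ∉ Set.range ι) :
    ∃ s' t' z', (∃ ω ∈ z', ω ∉ Set.range ι) ∧
      IsDetour (MonoidHom.id Γ) φ ι F C π t₀ s' t' z' := by
  -- With the identity homomorphism no part may be walked twice, so the ear is taken forwards in
  -- time; its reverse contains `inv ω`, again a new letter.
  rcases lt_or_gt_of_ne hne with h' | h'
  · exact ⟨t, t₀, invWord inv z,
      ⟨inv ω, by simpa [invWord] using ⟨ω, hω, rfl⟩, fun hr => hωι (hι _ hr)⟩,
      h.reverse hinv, fun hle => by omega⟩
  · exact ⟨t₀, t, z, ⟨ω, hω, hωι⟩, h, fun hle => by omega⟩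

open Classical in
/-- Independent insertions of `ω` at times where `ω` can be inserted. -/
lemma rewritable_of_insertions {φ : β → Γ} {ι : α → β} {inv : α → α} {ω : β}
    (hinv : ∀ a, φ (ι (inv a)) = (φ (ι a))⁻¹)
    (hgen : ∀ g : Γ, ∃ u : List α, (u.map (φ ∘ ι)).prod = g) (hω : φ ω ≠ 1)
    (hωι : ω ∉ Set.range ι) {D C r : ℕ} (hD : 0 < D) {π : List α} (hπ : π.length = D * r)
    (hav : Avoiding (φ ∘ ι) π) {J : Finset ℕ} (hJ : J ⊆ Finset.range r) (hJc : r ≤ 4 * J.card)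
    (t : ℕ → ℕ) (ht : ∀ j ∈ J, t j / D = j)
    (h₁ : ∀ j ∈ J, ∀ e, 1 ≤ t j → π[t j - 1]? = some e → ¬ Linked (φ ∘ ι) (φ ω) (φ (ι e))⁻¹)
    (h₂ : ∀ j ∈ J, ∀ a, t j + 1 < π.length → π[t j]? = some a →
      ¬ Linked (φ ∘ ι) (φ ω)⁻¹ (φ (ι a))) :
    Rewritable ι (Plain ι) (Avoiding φ) D (2 * D + 1 + C) r π := by
  have huv : ∀ j, ∃ u v, splice ι (block D π j) (t j % D) (t j % D) [ω] = u ++ v ∧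
      ∀ p : List α, ¬ Plain ι (p.map ι ++ u) ∧ Plain ι (p.map ι ++ u.dropLast) :=
    fun j => exists_first_not_plain (not_plain_splice (by simp) hωι)
  choose u v huv hmark using huv
  refine ⟨J, hJ, hJc, u, v, fun j hj => ?_, fun T hT => ?_, fun j hj i _ => hmark j _⟩
  · have h1 : (u j).length + (v j).length ≤ 2 * D + 1 := by
      rw [← List.length_append, ← huv j]
      have hb := length_block hπ (Finset.mem_range.1 (hJ hj))
      simp only [splice, List.length_append, List.length_map, List.length_take,
        List.length_drop, hb, List.length_singleton]
      omega
    omega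
  -- Rewriting the blocks in `T` is the same as flagging the times `t j` for `j ∈ T` in the whole
  -- word.
  · set P : ℕ → Bool := fun i => decide (∃ j ∈ T, t j = i) with hP
    have hPt : ∀ i, P i = true ↔ ∃ j ∈ T, t j = i := fun i => decide_eq_true_iff
    have e : (pieces D π u v T r).flatMap (Piece.out ι) =
        insertFlagged ι ω (annotate P 0 π) := by
      rw [flatMap_out_pieces, insertFlagged_annotate_flatMap P hπ]
      refine List.flatMap_congr fun j hj => ?_
      have hb := length_block hπ (List.mem_range.1 hj)
      have hdiv : ∀ i < D, (D * j + i) / D = j := fun i hi => by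
        rw [Nat.mul_add_div hD, Nat.div_eq_of_lt hi, add_zero]
      split_ifs with hjT
      · rw [← huv j]
        refine (insertFlagged_annotate_of_unique (by rw [hb]; exact Nat.mod_lt _ hD)
          fun i hi => ?_).symm
        rw [hb] at hi
        rw [hPt]
        constructor
        · rintro ⟨j', hj', e⟩
          have h1 := ht j' (hT hj')
          rw [e, hdiv i hi] at h1
          subst h1
          rw [e, Nat.mul_add_mod, Nat.mod_eq_of_lt hi]
        · rintro rfl
          refine ⟨j, hjT, ?_⟩
          have := Nat.div_add_mod (t j) D
          rw [ht j (hT hjT)] at this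
          exact this.symm
      · refine (insertFlagged_annotate_of_false fun i hi => ?_).symm
        rw [hb] at hi
        rw [← Bool.not_eq_true, hPt]
        rintro ⟨j', hj', e⟩
        have h1 := ht j' (hT hj')
        rw [e, hdiv i hi] at h1
        exact hjT (h1 ▸ hj')
    rw [e]
    refine avoiding_insertFlagged hinv hgen hω _ (by rwa [map_fst_annotate]) ?_
    intro a b W' hW'
    rcases π with _ | ⟨a', π⟩
    · simp [annotate] at hW'
    rw [annotate] at hW'
    obtain ⟨h1, rfl⟩ := List.cons.inj hW'
    obtain ⟨rfl, rfl⟩ := Prod.mk.inj h1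
    refine ⟨fun hP0 hne => ?_, insertable_annotate fun i e' a hPi he' ha => ?_⟩
    · obtain ⟨j, hj, htj⟩ := (hPt 0).1 hP0
      have hl := List.length_pos_iff.2 hne
      rw [length_annotate] at hl
      exact h₂ j (hT hj) a' (by rw [htj]; simpa using hl) (by rw [htj]; rfl)
    · obtain ⟨j, hj, htj⟩ := (hPt _).1 hPi
      rw [zero_add] at htj
      refine ⟨h₁ j (hT hj) e' (by omega) ?_, fun hi => h₂ j (hT hj) a ?_ ?_⟩
      · rw [htj, show 1 + i - 1 = i by omega]; exact he'
      · rw [htj, List.length_cons]; omega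
      · rw [htj, add_comm, List.getElem?_cons_succ]; exact ha

end WordWalk

/-! ### Adding a new generator. -/

namespace WordWalk

variable {α β Γ H : Type*} [Group Γ] [Group H]

lemma pos_succ (φ : α → Γ) {w : List α} {k : ℕ} (hk : k < w.length) :
    pos φ w (k + 1) = pos φ w k * φ w[k] := by
  rw [pos, List.take_succ_eq_append_getElem hk, List.map_append, List.prod_append]
  simp only [pos, List.map_cons, List.map_nil, List.prod_singleton]

/-- The number of self-avoiding words grows strictly faster if a new generator is added. -/
theorem not_growthLE_of_new_generator [Finite α] [Finite β] {φ : β → Γ} {ι : α → β}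
    (hι : Function.Injective ι) {inv : β → β} (hinv : ∀ b, φ (inv b) = (φ b)⁻¹)
    (hinvι : ∀ b, inv b ∈ Set.range ι → b ∈ Set.range ι) {inv' : α → α}
    (hinv' : ∀ a, φ (ι (inv' a)) = (φ (ι a))⁻¹)
    (hgen : ∀ g : Γ, ∃ u : List α, (u.map (φ ∘ ι)).prod = g) {ω : β} (hω : φ ω ≠ 1)
    (hωι : ω ∉ Set.range ι) {l : ℝ} (hl : 1 ≤ l)
    (hlb : ∀ n, l ^ n ≤ ((words (φ ∘ ι) n).card : ℝ))
    (hub : GrowthLE (fun n => (words (φ ∘ ι) n).card) l) :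
    ¬ GrowthLE (fun n => (words φ n).card) l := by
  classical
  have := Fintype.ofFinite α
  have := Fintype.ofFinite β
  have hch : ∀ (b : β) (g : Γ), ∃ u : List α, Linked (φ ∘ ι) (φ b) g →
      φ b * (u.map (φ ∘ ι)).prod = g ∧ (∀ i ≤ u.length, φ b * pos (φ ∘ ι) u i ≠ 1) ∧
        Avoiding (φ ∘ ι) u := by
    intro b g
    by_cases h : Linked (φ ∘ ι) (φ b) g
    · obtain ⟨u, hu⟩ := h.exists_avoiding
      exact ⟨u, fun _ => hu⟩
    · exact ⟨[], fun h' => absurd h' h⟩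
  choose u hu using hch
  -- Only these finitely many pairs occur, so one finite neighbourhood `F` and one length bound `c`
  -- serve all linking words; an unlinked pair has the default word `[]`.
  set S : Finset (β × Γ) := Finset.univ ×ˢ
    (Finset.univ.image (fun a => φ (ι a)) ∪ Finset.univ.image (fun a => (φ (ι a))⁻¹)) with hS
  have hSm : ∀ b a, (b, φ (ι a)) ∈ S := fun b a => by simp [hS]
  have hSm' : ∀ b a, (b, (φ (ι a))⁻¹) ∈ S := fun b a => by
    simp only [hS, Finset.mem_product, Finset.mem_univ, true_and, Finset.mem_union,
      Finset.mem_image]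
    exact Or.inr ⟨a, rfl⟩
  set F : Finset Γ := insert 1 (S.biUnion fun p =>
    (Finset.range ((u p.1 p.2).length + 1)).image fun i => φ p.1 * pos (φ ∘ ι) (u p.1 p.2) i)
    with hF
  have hF1 : 1 ∈ F := Finset.mem_insert_self _ _
  have hFm : ∀ b g, (b, g) ∈ S → ∀ i ≤ (u b g).length, φ b * pos (φ ∘ ι) (u b g) i ∈ F :=
    fun b g hbg i hi => Finset.mem_insert_of_mem (Finset.mem_biUnion.2 ⟨(b, g), hbg,
      Finset.mem_image.2 ⟨i, Finset.mem_range.2 (by dsimp only; omega), rfl⟩⟩)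
  set c : ℕ := ∑ p ∈ S, (u p.1 p.2).length with hc
  have hcm : ∀ b g, (b, g) ∈ S → (u b g).length < 1 + c := fun b g hbg => by
    have : (u b g).length ≤ c :=
      Finset.single_le_sum (f := fun p : β × Γ => (u p.1 p.2).length)
        (fun _ _ => Nat.zero_le _) hbg
    omega
  set E : Finset Γ := (F ×ˢ F).image fun p => p.1 * p.2⁻¹ with hE
  have hFE : ∀ g ∈ F, ∀ h ∈ F, g * h⁻¹ ∈ E := fun g hg h hh =>
    Finset.mem_image.2 ⟨(g, h), Finset.mem_product.2 ⟨hg, hh⟩, rfl⟩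
  obtain ⟨D, hD, hfreq⟩ := exists_scale (by linarith) hlb hub E
  have hmain := not_growthLE_of_rewritable (ι := ι) (K := Plain ι) (A := Avoiding φ) hι
    (fun u v huv hv b hb => hv b (huv.subset hb)) hl (C := 2 * D + 1 + c) hD
    (fun x hx hxl => (hfreq x hx hxl).mono fun r hr =>
      ⟨goodWords (φ ∘ ι) E D r, hr, fun π hπ => ?_⟩)
  · simpa only [wordsWith_avoiding] using hmain
  · obtain ⟨hw, hgood⟩ := Finset.mem_filter.1 hπ
    obtain ⟨hlen, hav⟩ := mem_words.1 hw
    refine ⟨hlen, ?_⟩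
    have hblk : ∀ j ∈ goodBlocks (φ ∘ ι) E D r π, ∃ t < π.length, t / D = j ∧
        Isolated (φ ∘ ι) E D π t := fun j hj => (Finset.mem_filter.1 hj).2
    choose! t ht hdiv hiso using hblk
    set J := goodBlocks (φ ∘ ι) E D r π with hJ
    have hJr : J ⊆ Finset.range r := Finset.filter_subset _ _
    -- `Q j` says that at time `t j` a new edge is linked to the preceding or the following vertex
    -- of the walk. At least half of the good blocks satisfy `Q`, giving ears, or at least half do
    -- not, allowing insertions; either way a quarter of all blocks remains.
    let Q : ℕ → Prop := fun j =>
      (∃ e, 1 ≤ t j ∧ π[t j - 1]? = some e ∧ Linked (φ ∘ ι) (φ ω) (φ (ι e))⁻¹) ∨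
      (∃ a, t j + 1 < π.length ∧ π[t j]? = some a ∧ Linked (φ ∘ ι) (φ ω)⁻¹ (φ (ι a)))
    have hQ := Finset.card_filter_add_card_filter_not (s := J) Q
    have hstep : ∀ k a, π[k]? = some a →
        pos (φ ∘ ι) π (k + 1) = pos (φ ∘ ι) π k * φ (ι a) := by
      intro k a hk
      obtain ⟨hk', rfl⟩ := List.getElem?_eq_some_iff.1 hk
      exact pos_succ _ hk'
    rcases le_total (J.filter Q).card (J.filter fun j => ¬ Q j).card with hle | hle
    · refine rewritable_of_insertions hinv' hgen hω hωι hD hlen hav (J := J.filter fun j => ¬ Q j)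
        ((Finset.filter_subset _ _).trans hJr) (by omega) t
        (fun j hj => hdiv j (Finset.mem_filter.1 hj).1) (fun j hj e h1 he hL => ?_)
        (fun j hj a h1 ha hL => ?_)
      · exact (Finset.mem_filter.1 hj).2 (Or.inl ⟨e, h1, he, hL⟩)
      · exact (Finset.mem_filter.1 hj).2 (Or.inr ⟨a, h1, ha, hL⟩)
    -- The common length bound `2 * D + 1 + c` is read as `2 * D + (1 + c)`: an ear has at most `1 +
    -- c` letters.
    · rw [add_assoc]
      refine rewritable_of_detours (f := MonoidHom.id Γ) (F := F) (E := E) hD hFE hF1 hlen hav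
        (J := J.filter Q) ((Finset.filter_subset _ _).trans hJr) (by omega) fun j hj => ?_
      obtain ⟨hjJ, hjQ⟩ := Finset.mem_filter.1 hj
      suffices h : ∃ s' t' z', (∃ ω ∈ z', ω ∉ Set.range ι) ∧
          IsDetour (MonoidHom.id Γ) φ ι F (1 + c) π (t j) s' t' z' by
        obtain ⟨s', t', z', ⟨ω', hω', hωι'⟩, hd⟩ := h
        refine ⟨t j, ht j hjJ, hdiv j hjJ, hiso j hjJ, s', t', z', hd, fun _ _ => ?_⟩
        obtain ⟨p, q, hpq, hm⟩ := exists_first_not_plain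
          (not_plain_splice (b := block D π j) (s := s' % D) (t := t' % D) hω' hωι')
        exact ⟨p, q, hpq, fun i _ => hm _⟩
      rcases hjQ with ⟨e, h1, he, hL⟩ | ⟨a, h1, ha, hL⟩
      · obtain ⟨h3, h4, h5⟩ := hu _ _ hL
        have hs := hstep _ _ he
        rw [Nat.sub_add_cancel h1] at hs
        obtain ⟨t', z, hne, hωz, hear⟩ := exists_ear (t₁ := t j - 1) (ht j hjJ)
          (by have := ht j hjJ; omega) (by rw [hs, mul_inv_cancel_right]) h3 h4 h5 hF1
          (hFm _ _ (hSm' _ _)) (hcm _ _ (hSm' _ _))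
        exact hear.exists_detour hne hinv hinvι hωz hωι
      · rw [← hinv] at hL
        obtain ⟨h3, h4, h5⟩ := hu _ _ hL
        obtain ⟨t', z, hne, hωz, hear⟩ := exists_ear (t₁ := t j + 1) (ht j hjJ)
          h1 (hstep _ _ ha).symm h3 h4 h5 hF1
          (hFm _ _ (hSm _ _)) (hcm _ _ (hSm _ _))
        exact hear.exists_detour hne hinv hinvι hωz fun h => hωι (hinvι _ h)

end WordWalk

/-! ### Growth rates of submultiplicative sequences. -/

namespace WordWalk

variable {α β Γ H : Type*} [Group Γ] [Group H]

section growth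

/-- Fekete's lemma for `log (a n)`. The limit is also an infimum, hence the lower bound `μ ^ n ≤ a
n` without an error term. -/
lemma exists_tendsto_root {a : ℕ → ℕ} (hpos : ∀ n, 1 ≤ a n)
    (hmul : ∀ m n, a (m + n) ≤ a m * a n) :
    ∃ μ : ℝ, 1 ≤ μ ∧ Tendsto (fun n : ℕ => (a n : ℝ) ^ (1 / (n : ℝ))) atTop (𝓝 μ) ∧
      ∀ n, μ ^ n ≤ (a n : ℝ) := by
  have hpos' : ∀ n, (0 : ℝ) < a n := fun n => by exact_mod_cast hpos n
  have hlog : ∀ n, 0 ≤ Real.log (a n) := fun n => Real.log_nonneg (by exact_mod_cast hpos n)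
  have hsub : Subadditive fun n => Real.log (a n) := fun m n => by
    rw [← Real.log_mul (hpos' m).ne' (hpos' n).ne']
    exact Real.log_le_log (hpos' _) (by exact_mod_cast hmul m n)
  have hbdd : BddBelow (Set.range fun n : ℕ => Real.log (a n) / n) :=
    ⟨0, by rintro _ ⟨n, rfl⟩; exact div_nonneg (hlog n) n.cast_nonneg⟩
  have hlim := hsub.tendsto_lim hbdd
  refine ⟨Real.exp hsub.lim, Real.one_le_exp (ge_of_tendsto' hlim fun n =>
    div_nonneg (hlog n) n.cast_nonneg), ?_, fun n => ?_⟩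
  · refine ((Real.continuous_exp.tendsto _).comp hlim).congr fun n => ?_
    rw [Function.comp, Real.rpow_def_of_pos (hpos' n), mul_one_div]
  · rw [← Real.exp_nat_mul, ← Real.le_log_iff_exp_le (hpos' n)]
    rcases eq_or_ne n 0 with rfl | hn
    · simpa using hlog 0
    · have := hsub.lim_le_div hbdd hn
      rwa [le_div_iff₀ (by positivity), mul_comm] at this

lemma tendsto_root_of_eq_zero {a : ℕ → ℕ} (hmul : ∀ m n, a (m + n) ≤ a m * a n) {N : ℕ}
    (hN : a N = 0) : Tendsto (fun n : ℕ => (a n : ℝ) ^ (1 / (n : ℝ))) atTop (𝓝 0) := by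
  refine tendsto_const_nhds.congr' ?_
  filter_upwards [eventually_ge_atTop N, eventually_gt_atTop 0] with n hn h0
  obtain ⟨k, rfl⟩ := Nat.exists_eq_add_of_le hn
  have h := hmul N k
  rw [hN, zero_mul, Nat.le_zero] at h
  rw [h, Nat.cast_zero, Real.zero_rpow (one_div_ne_zero (Nat.cast_ne_zero.2 h0.ne'))]

lemma growthLE_of_tendsto_root {a : ℕ → ℕ} {μ l : ℝ} (hμl : μ ≤ l)
    (h : Tendsto (fun n : ℕ => (a n : ℝ) ^ (1 / (n : ℝ))) atTop (𝓝 μ)) : GrowthLE a l := by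
  intro x hx
  have hμ : 0 ≤ μ := ge_of_tendsto' h fun n => by positivity
  have hx0 : 0 < x := by linarith
  obtain ⟨N, hN⟩ := eventually_atTop.1
    ((h.eventually (gt_mem_nhds (hμl.trans_lt hx))).and (eventually_gt_atTop 0))
  have hs : 0 ≤ ∑ i ∈ Finset.range N, (a i : ℝ) / x ^ i :=
    Finset.sum_nonneg fun i _ => by positivity
  refine ⟨1 + ∑ i ∈ Finset.range N, (a i : ℝ) / x ^ i, by linarith, fun n => ?_⟩
  rw [← div_le_iff₀ (by positivity)]
  rcases lt_or_ge n N with hn | hn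
  · have := Finset.single_le_sum (f := fun i => (a i : ℝ) / x ^ i)
      (fun i _ => by positivity) (Finset.mem_range.2 hn)
    linarith
  · obtain ⟨h1, h2⟩ := hN n hn
    have h3 : (a n : ℝ) ≤ x ^ n := by
      have h4 := pow_le_pow_left₀ (by positivity) h1.le n
      rwa [← Real.rpow_natCast, ← Real.rpow_mul (by positivity),
        one_div_mul_cancel (Nat.cast_ne_zero.2 h2.ne'), Real.rpow_one] at h4
    have := (div_le_one (by positivity)).2 h3
    linarith

lemma GrowthLE.words [Finite α] {φ : α → Γ} {l : ℝ} (hl : 0 ≤ l)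
    (h : GrowthLE (fun n => (fullWords φ n).card) l) :
    GrowthLE (fun n => (words φ n).card) l := by
  intro x hx
  have hx0 : 0 < x := by linarith
  obtain ⟨C, hC, hCx⟩ := h x hx
  refine ⟨Nat.card α * C / x + (WordWalk.words φ 0).card + 1, by positivity, fun n => ?_⟩
  rcases n with _ | n
  · have : 0 ≤ Nat.card α * C / x := by positivity
    simp only [pow_zero, mul_one]
    linarith
  · calc ((WordWalk.words φ (n + 1)).card : ℝ)
        ≤ Nat.card α * (fullWords φ n).card := by exact_mod_cast card_words_succ_le φ n
      _ ≤ Nat.card α * (C * x ^ n) := by gcongr; exact hCx n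
      _ = (Nat.card α * C / x) * x ^ (n + 1) := by rw [pow_succ]; field_simp
      _ ≤ _ := by gcongr; linarith [(Nat.cast_nonneg (WordWalk.words φ 0).card : (0 : ℝ) ≤ _)]

/-- Comparison of two growth rates by means of a criterion on half-open words. -/
lemma lt_of_not_growthLE [Finite α] [Finite β] {φ : α → Γ} {ψ : β → H} {l μ : ℝ} (hl : 1 ≤ l)
    (hlim : Tendsto (fun n : ℕ => ((fullWords ψ n).card : ℝ) ^ (1 / (n : ℝ))) atTop (𝓝 l))
    (hlb : ∀ n, l ^ n ≤ ((fullWords ψ n).card : ℝ))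
    (hμ : Tendsto (fun n : ℕ => ((fullWords φ n).card : ℝ) ^ (1 / (n : ℝ))) atTop (𝓝 μ))
    (h : (∀ n, l ^ n ≤ ((words ψ n).card : ℝ)) → GrowthLE (fun n => (words ψ n).card) l →
      ¬ GrowthLE (fun n => (words φ n).card) l) : l < μ := by
  by_contra! hμl
  exact h (fun n => (hlb n).trans (by exact_mod_cast card_fullWords_le_card_words ψ n))
    ((growthLE_of_tendsto_root le_rfl hlim).words (by linarith))
    ((growthLE_of_tendsto_root hμl hμ).words (by linarith))

end growth

/-! ### Walks in Cayley graphs as words. -/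

section cayley

variable {T : Set Γ}

lemma mulCayley_adj_iff (hT : ∀ t ∈ T, t⁻¹ ∈ T) {x y : Γ} :
    (SimpleGraph.mulCayley T).Adj x y ↔ x ≠ y ∧ x⁻¹ * y ∈ T := by
  rw [SimpleGraph.mulCayley_adj]
  refine and_congr_right fun _ => ⟨?_, Or.inl⟩
  rintro (h | h)
  · exact h
  · simpa using hT _ h

/-- The word of generators read off along a walk in a Cayley graph. -/
def labels (hT : ∀ t ∈ T, t⁻¹ ∈ T) {u v : Γ} (p : (SimpleGraph.mulCayley T).Walk u v) : List T :=
  List.ofFn fun i : Fin p.length => ⟨(p.getVert i)⁻¹ * p.getVert (i + 1),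
    ((mulCayley_adj_iff hT).1 (p.adj_getVert_succ i.2)).2⟩

lemma length_labels (hT : ∀ t ∈ T, t⁻¹ ∈ T) {u v : Γ} (p : (SimpleGraph.mulCayley T).Walk u v) :
    (labels hT p).length = p.length := by simp [labels]

lemma mul_pos_labels (hT : ∀ t ∈ T, t⁻¹ ∈ T) {u v : Γ} (p : (SimpleGraph.mulCayley T).Walk u v)
    {i : ℕ} (hi : i ≤ p.length) : u * pos Subtype.val (labels hT p) i = p.getVert i := by
  induction i with
  | zero => simp
  | succ i ih =>
    rw [pos_succ _ (by rw [length_labels]; exact hi), ← mul_assoc, ih (by omega)]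
    simp [labels]

lemma isPath_iff_fullyAvoiding_labels (hT : ∀ t ∈ T, t⁻¹ ∈ T) {u v : Γ}
    (p : (SimpleGraph.mulCayley T).Walk u v) :
    p.IsPath ↔ FullyAvoiding Subtype.val (labels hT p) := by
  rw [← SimpleGraph.Walk.IsPath.getVert_injOn_iff]
  constructor
  · intro h i j hij hj e
    rw [length_labels] at hj
    refine hij.ne (h (show i ≤ _ by omega) hj ?_)
    rw [← mul_pos_labels hT p (by omega), e, mul_pos_labels hT p hj]
  · intro h i hi j hj e
    rw [Set.mem_ofPred_eq] at hi hj
    rw [← mul_pos_labels hT p hi, ← mul_pos_labels hT p hj] at e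
    have e := mul_left_cancel e
    rw [← length_labels hT] at hi hj
    by_contra hij
    rcases lt_or_gt_of_ne hij with h' | h'
    · exact h i j h' hj e
    · exact h j i h' hi e.symm

lemma labels_injective (hT : ∀ t ∈ T, t⁻¹ ∈ T) {u v v' : Γ}
    {p : (SimpleGraph.mulCayley T).Walk u v} {q : (SimpleGraph.mulCayley T).Walk u v'}
    (h : labels hT p = labels hT q) :
    (⟨v, p⟩ : Σ v, (SimpleGraph.mulCayley T).Walk u v) = ⟨v', q⟩ := by
  have hl : p.length = q.length := by rw [← length_labels hT, h, length_labels]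
  have hv : ∀ i ≤ p.length, p.getVert i = q.getVert i := fun i hi => by
    rw [← mul_pos_labels hT p hi, h, mul_pos_labels hT q (hl ▸ hi)]
  obtain rfl : v = v' := by
    have := hv _ le_rfl
    rwa [p.getVert_length, hl, q.getVert_length] at this
  rw [SimpleGraph.Walk.ext_getVert_le_length hl hv]

lemma exists_labels_eq (hT : ∀ t ∈ T, t⁻¹ ∈ T) (w : List T) (u : Γ)
    (hw : FullyAvoiding Subtype.val w) :
    ∃ v, ∃ p : (SimpleGraph.mulCayley T).Walk u v, labels hT p = w := by
  induction w generalizing u with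
  | nil => exact ⟨u, .nil, by simp [labels]⟩
  | cons a w ih =>
    have hne : (a : Γ) ≠ 1 := by
      have := hw 0 1 one_pos (by simp)
      rw [pos_zero, pos_cons_succ, pos_zero, mul_one] at this
      exact this.symm
    obtain ⟨v, p, rfl⟩ := ih (u * a) (hw.drop 1)
    have hadj : (SimpleGraph.mulCayley T).Adj u (u * a) :=
      (mulCayley_adj_iff hT).2 ⟨fun e => hne (left_eq_mul.1 e), by simp⟩
    exact ⟨v, .cons hadj p, by simp [labels, List.ofFn_succ]⟩

lemma sawCount_mulCayley [Finite T] (hT : ∀ t ∈ T, t⁻¹ ∈ T) (v : Γ) (n : ℕ) :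
    sawCount (SimpleGraph.mulCayley T) v n =
      (fullWords (Subtype.val : T → Γ) n).card := by
  rw [sawCount, ← Set.ncard_coe_finset]
  refine Set.ncard_congr (fun p _ => labels hT p.2) (fun p hp => ?_) (fun p q _ _ h => ?_)
    (fun w hw => ?_)
  · exact mem_fullWords.2 ⟨(length_labels hT _).trans hp.2,
      (isPath_iff_fullyAvoiding_labels hT _).1 hp.1⟩
  · exact labels_injective hT h
  · obtain ⟨hn, hw⟩ := mem_fullWords.1 hw
    obtain ⟨u, p, rfl⟩ := exists_labels_eq hT w v hw
    exact ⟨⟨u, p⟩, ⟨(isPath_iff_fullyAvoiding_labels hT _).2 hw, (length_labels hT p) ▸ hn⟩, rfl⟩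

lemma isConnectiveConstant_mulCayley_iff [Finite T] (hT : ∀ t ∈ T, t⁻¹ ∈ T) {μ : ℝ} :
    IsConnectiveConstant (SimpleGraph.mulCayley T) μ ↔
      Tendsto (fun n : ℕ => ((fullWords (Subtype.val : T → Γ) n).card : ℝ) ^ (1 / (n : ℝ)))
        atTop (𝓝 μ) := by
  simp [IsConnectiveConstant, sawCount_mulCayley hT]

end cayley

end WordWalk

/-! ### Assembling the two inequalities. -/

namespace WordWalk

variable {α β Γ H : Type*} [Group Γ] [Group H]

lemma exists_fullyAvoiding_prod {φ : α → Γ} {g : Γ} (h : ∃ u : List α, (u.map φ).prod = g) :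
    ∃ u : List α, (u.map φ).prod = g ∧ FullyAvoiding φ u := by
  classical
  have hex : ∃ n, ∃ u : List α, u.length = n ∧ (u.map φ).prod = g := by
    obtain ⟨u, hu⟩ := h
    exact ⟨_, u, rfl, hu⟩
  obtain ⟨u, hlen, hu⟩ := Nat.find_spec hex
  refine ⟨u, hu, fun i j hij hj e => ?_⟩
  refine Nat.find_min hex (m := (u.take i ++ u.drop j).length) ?_ ⟨_, rfl, ?_⟩
  · rw [← hlen, List.length_append, List.length_take, List.length_drop]
    omega
  · rw [List.map_append, List.prod_append, prod_take, e, pos_mul_prod_drop, hu]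

/-- A shortest word for an element is self-avoiding, and so are its prefixes. If none had length
`n`, every element would be the value of one of the finitely many words shorter than `n`. -/
lemma one_le_card_fullWords [Finite α] [Infinite Γ] {φ : α → Γ}
    (hgen : ∀ g : Γ, ∃ u : List α, (u.map φ).prod = g) (n : ℕ) : 1 ≤ (fullWords φ n).card := by
  rw [Nat.one_le_iff_ne_zero, Finset.card_ne_zero]
  by_contra hn
  rw [Finset.not_nonempty_iff_eq_empty] at hn
  refine Set.infinite_univ (α := Γ)
    (((List.finite_length_lt α n).image fun u => (u.map φ).prod).subset fun g _ => ?_)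
  obtain ⟨u, hu, hfull⟩ := exists_fullyAvoiding_prod (hgen g)
  refine ⟨u, ?_, hu⟩
  by_contra hlen
  rw [Set.mem_ofPred_eq, not_lt] at hlen
  have : u.take n ∈ fullWords φ n := mem_fullWords.2 ⟨by simpa using hlen, hfull.take n⟩
  rw [hn] at this
  simp at this

lemma card_fullWords_comp_le [Finite α] [Finite β] (φ : β → Γ) {ι : α → β}
    (hι : Function.Injective ι) (n : ℕ) :
    (fullWords (φ ∘ ι) n).card ≤ (fullWords φ n).card := by
  refine Finset.card_le_card_of_injOn (List.map ι) (fun w hw => ?_)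
    (List.map_injective_iff.2 hι).injOn
  rw [Finset.mem_coe, mem_fullWords] at hw ⊢
  refine ⟨by simp [hw.1], ?_⟩
  simpa [FullyAvoiding, pos_map] using hw.2

lemma exists_prod_eq_of_closure {S : Set Γ} (hinv : ∀ s ∈ S, s⁻¹ ∈ S)
    (hS : Subgroup.closure S = ⊤) (g : Γ) :
    ∃ u : List S, (u.map (Subtype.val : S → Γ)).prod = g := by
  have hg : g ∈ Subgroup.closure S := hS ▸ Subgroup.mem_top g
  induction hg using Subgroup.closure_induction with
  | mem x hx => exact ⟨[⟨x, hx⟩], by simp⟩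
  | one => exact ⟨[], by simp⟩
  | mul x y _ _ hx hy =>
    obtain ⟨u, rfl⟩ := hx
    obtain ⟨v, rfl⟩ := hy
    exact ⟨u ++ v, by simp⟩
  | inv x _ hx =>
    obtain ⟨u, rfl⟩ := hx
    exact ⟨_, prod_map_invWord (inv := fun s : S => ⟨(s : Γ)⁻¹, hinv _ s.2⟩) (fun _ => rfl) u⟩

lemma exists_hom_presentedGroup {S : Set Γ} {R R' : Set (FreeGroup S)} (hR : IsPresentation S R)
    (hRR' : R ⊆ R') (hsurj : Function.Surjective (wordValue S)) :
    ∃ f : Γ →* PresentedGroup R', ∀ x, f (wordValue S x) = PresentedGroup.mk R' x := by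
  have hker : (wordValue S).ker ≤ (PresentedGroup.mk R').ker := by
    rw [← hR.2]
    refine Subgroup.normalClosure_le_normal fun r hr => ?_
    exact MonoidHom.mem_ker.2 (PresentedGroup.one_of_mem (hRR' hr))
  exact ⟨(wordValue S).liftOfSurjective hsurj ⟨_, hker⟩,
    fun x => MonoidHom.liftOfRightInverse_comp_apply _ _ _ ⟨_, hker⟩ x⟩

lemma wordValue_surjective {S : Set Γ} (hinv : ∀ s ∈ S, s⁻¹ ∈ S)
    (hS : Subgroup.closure S = ⊤) : Function.Surjective (wordValue S) := by
  intro g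
  obtain ⟨u, rfl⟩ := exists_prod_eq_of_closure hinv hS g
  exact ⟨(u.map FreeGroup.of).prod, by simp [wordValue, map_list_prod, Function.comp_def]⟩

lemma exists_presentedCayley_lt [Infinite Γ] {S : Set Γ} [Finite S] (hinv : ∀ s ∈ S, s⁻¹ ∈ S)
    {R : Set (FreeGroup S)} (hR : IsPresentation S R) {μ : ℝ} (hμ1 : 1 ≤ μ)
    (hμ : Tendsto (fun n : ℕ => ((fullWords (Subtype.val : S → Γ) n).card : ℝ) ^ (1 / (n : ℝ)))
      atTop (𝓝 μ)) {ρ : FreeGroup S} (hρ : wordValue S ρ ≠ 1) :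
    ∃ μρ : ℝ, IsConnectiveConstant (presentedCayley (R ∪ {ρ})) μρ ∧ μρ < μ := by
  obtain ⟨f, hf⟩ := exists_hom_presentedGroup hR Set.subset_union_left
    (R' := R ∪ {ρ}) (wordValue_surjective hinv hR.1)
  have hfS : ∀ s : S, f s = PresentedGroup.of s := fun s => by
    have := hf (FreeGroup.of s)
    rwa [wordValue, FreeGroup.lift_apply_of] at this
  set T := Set.range (PresentedGroup.of : S → PresentedGroup (R ∪ {ρ})) with hT
  have hTfin : Finite T := Set.finite_range _
  have hTinv : ∀ t ∈ T, t⁻¹ ∈ T := by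
    rintro _ ⟨s, rfl⟩
    exact ⟨⟨_, hinv _ s.2⟩, by rw [← hfS, ← hfS, ← map_inv]⟩
  -- Generators may become equal in the quotient. Choosing one preimage of each embeds the words
  -- over `T` into the words over `S`, so the quotient's connective constant is at most the growth
  -- rate `l` of words over `S`.
  choose e he using fun t : T => t.2
  have he' : (f ∘ (Subtype.val : S → Γ)) ∘ e = Subtype.val := funext fun t => by
    rw [← he t]; exact hfS _
  have hei : Function.Injective e := fun t t' h => Subtype.ext (by rw [← he t, h, he t'])
  have hle : ∀ n, (fullWords (Subtype.val : T → _) n).card ≤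
      (fullWords (f ∘ (Subtype.val : S → Γ)) n).card := fun n => by
    have := card_fullWords_comp_le (f ∘ (Subtype.val : S → Γ)) hei n
    rwa [he'] at this
  have hker : ∃ w : List S, f (w.map (Subtype.val : S → Γ)).prod = 1 ∧
      (w.map (Subtype.val : S → Γ)).prod ≠ 1 := by
    obtain ⟨w, hw⟩ := exists_prod_eq_of_closure hinv hR.1 (wordValue S ρ)
    exact ⟨w, by rw [hw, hf]; exact PresentedGroup.one_of_mem (by simp), by rwa [hw]⟩
  by_cases h0 : ∀ n, 1 ≤ (fullWords (Subtype.val : T → PresentedGroup (R ∪ {ρ})) n).card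
  · obtain ⟨μρ, -, hlim, -⟩ := exists_tendsto_root h0 (card_fullWords_add_le _)
    obtain ⟨l, hl, hllim, hlb⟩ := exists_tendsto_root
      (fun n => (h0 n).trans (hle n)) (card_fullWords_add_le _)
    refine ⟨μρ, (isConnectiveConstant_mulCayley_iff hTinv).2 hlim, (le_of_tendsto_of_tendsto' hlim hllim fun n => ?_).trans_lt
      (lt_of_not_growthLE hl hllim hlb hμ fun h1 h2 => not_growthLE_of_quotient
        (inv := fun s : S => ⟨(s : Γ)⁻¹, hinv _ s.2⟩) (fun _ => rfl) hker hl h1 h2)⟩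
    exact Real.rpow_le_rpow (Nat.cast_nonneg _) (by exact_mod_cast hle n) (by positivity)
  -- Some count vanishes, hence so do all later ones: the connective constant is 0, while `μ ≥ 1`.
  · push Not at h0
    obtain ⟨N, hN⟩ := h0
    exact ⟨0, (isConnectiveConstant_mulCayley_iff hTinv).2
      (tendsto_root_of_eq_zero (card_fullWords_add_le _) (Nat.lt_one_iff.1 hN)), by linarith⟩

lemma exists_mulCayley_insert_gt {S : Set Γ} [Finite S] (hinv : ∀ s ∈ S, s⁻¹ ∈ S)
    (hS : Subgroup.closure S = ⊤) {μ : ℝ} (hμ1 : 1 ≤ μ)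
    (hμ : Tendsto (fun n : ℕ => ((fullWords (Subtype.val : S → Γ) n).card : ℝ) ^ (1 / (n : ℝ)))
      atTop (𝓝 μ)) (hlb : ∀ n, μ ^ n ≤ ((fullWords (Subtype.val : S → Γ) n).card : ℝ))
    {w : Γ} (hw1 : w ≠ 1) (hwS : w ∉ S) :
    ∃ μw : ℝ, IsConnectiveConstant (SimpleGraph.mulCayley (S ∪ {w, w⁻¹})) μw ∧ μ < μw := by
  set T : Set Γ := S ∪ {w, w⁻¹} with hT
  have hTfin : Finite T := ((Set.toFinite S).union (Set.toFinite _)).to_subtype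
  have hTinv : ∀ t ∈ T, t⁻¹ ∈ T := by
    rintro t (ht | rfl | rfl)
    · exact Or.inl (hinv t ht)
    · simp [hT]
    · simp [hT]
  let ι : S → T := Set.inclusion Set.subset_union_left
  have hι : Function.Injective ι := Set.inclusion_injective _
  have hιmem : ∀ b : T, b ∈ Set.range ι ↔ (b : Γ) ∈ S := fun b =>
    ⟨by rintro ⟨s, rfl⟩; exact s.2, fun h => ⟨⟨b, h⟩, rfl⟩⟩
  have hpos : ∀ n, 1 ≤ (fullWords (Subtype.val : T → Γ) n).card := fun n => by
    refine le_trans ?_ (card_fullWords_comp_le (Subtype.val : T → Γ) hι n)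
    exact_mod_cast (one_le_pow₀ hμ1).trans (hlb n)
  obtain ⟨μw, -, hlim, -⟩ := exists_tendsto_root hpos (card_fullWords_add_le _)
  refine ⟨μw, (isConnectiveConstant_mulCayley_iff hTinv).2 hlim, ?_⟩
  refine lt_of_not_growthLE hμ1 hμ hlb hlim fun h1 h2 => ?_
  refine not_growthLE_of_new_generator (φ := (Subtype.val : T → Γ)) hι
    (inv := fun t => ⟨(t : Γ)⁻¹, hTinv _ t.2⟩) (fun _ => rfl) (fun b hb => ?_)
    (inv' := fun s => ⟨(s : Γ)⁻¹, hinv _ s.2⟩) (fun _ => rfl)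
    (exists_prod_eq_of_closure hinv hS) (ω := ⟨w, by simp [hT]⟩) hw1
    (fun h => hwS ((hιmem _).1 h)) hμ1 h1 h2
  rw [hιmem] at hb ⊢
  simpa using hinv _ hb

end WordWalk

theorem theorem4p1 {Γ : Type*} [Group Γ] [Infinite Γ] (S : Set Γ) (hfin : S.Finite)
    (hinv : ∀ s ∈ S, s⁻¹ ∈ S) (hone : (1 : Γ) ∉ S)
    (R : Set (FreeGroup S)) (hR : IsPresentation S R) :
    ∃ μ : ℝ, IsConnectiveConstant (SimpleGraph.mulCayley S) μ ∧
      (∀ ρ : FreeGroup S, wordValue S ρ ≠ 1 →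
        ∃ μρ : ℝ, IsConnectiveConstant (presentedCayley (R ∪ {ρ})) μρ ∧ μρ < μ) ∧
      (∀ w : Γ, w ≠ 1 → w ∉ S →
        ∃ μw : ℝ, IsConnectiveConstant (SimpleGraph.mulCayley (S ∪ {w, w⁻¹})) μw ∧ μ < μw) := by
  have := hfin.to_subtype
  obtain ⟨μ, hμ1, hμ, hlb⟩ := WordWalk.exists_tendsto_root
    (WordWalk.one_le_card_fullWords (WordWalk.exists_prod_eq_of_closure hinv hR.1))
    (WordWalk.card_fullWords_add_le _)
  exact ⟨μ, (WordWalk.isConnectiveConstant_mulCayley_iff hinv).2 hμ,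
    fun ρ hρ => WordWalk.exists_presentedCayley_lt hinv hR hμ1 hμ hρ,
    fun w hw1 hwS => WordWalk.exists_mulCayley_insert_gt hinv hR.1 hμ1 hμ hlb hw1 hwS⟩
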